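/- Let $(X,\mu)$ be a measure space such that the complex Hilbert space $L^2(X,\mu)$ is separable. For a measurable set $E\subseteq X$ let $P_E$ be the standard projection $f\mapsto \chi_E f$ on $L^2(X,\mu)$; its range, the set of all $f\in L^2(X,\mu)$ that vanish a.e. on $X\setminus E$, is called a standard subspace and is identified with $L^2(E,\mu|_E)$. Let $M^\infty(X,\mu)$ be the algebra of all multiplication operators $f\mapsto\varphi f$ with $\varphi\in L^\infty(X,\mu)$. Let $K$ be a bounded operator on $L^2(X,\mu)$ of finite rank $n\ge 1$ that has increasing spectrum relative to standard compressions, i.e. $$\sigma\bigl(PK|_{\operatorname{ran}P}\bigr)\subseteq\sigma\bigl(QK|_{\operatorname{ran}Q}\bigr)$$ for all standard projections $P,Q$ with $\operatorname{ran}P\subseteq\operatorname{ran}Q$. Then: (1) $K$ admits a standard, multiplicity-free triangularization: there is a family $\{P_\lambda\}_{\lambda\in\Lambda}$ of standard projections such that the subspaces $\operatorname{ran}P_\lambda$ are all invariant under $K$, are totally ordered by inclusion and form a maximal totally ordered family of standard subspaces, and such that the closed linear span of $\{P_\lambda\}_{\lambda\in\Lambda}$ in the weak operator topology equals $M^\infty(X,\mu)$.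 (2) There exist a positive integer $m\le 2n+1$ and a partition $\{E_1,\dots,E_m\}$ of $X$ into measurable sets with $L^2(E_j,\mu|_{E_j})\ne\{0\}$ such that, relative to the decomposition $L^2(X,\mu)=\bigoplus_{j=1}^m L^2(E_j,\mu|_{E_j})$, the operator $K$ is block upper triangular: $K_{i,j}:=P_{E_i}K|_{\operatorname{ran}P_{E_j}}=0$ whenever $i>j$. Moreover, if a diagonal block $K_{j,j}$ is non-zero, then $L^2(E_j,\mu|_{E_j})$ is one-dimensional and $K_{j,j}$ is multiplication by a non-zero eigenvalue of $K$. -/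

import Mathlib

open MeasureTheory Filter
open scoped ENNReal

noncomputable section

namespace StdTri

variable {X : Type*} [MeasurableSpace X]

/-- The standard subspace of `L²(X, μ)` attached to `E`: the functions that vanish a.e. on the
complement of `E`. It is the usual copy of `L²(E, μ|_E)` inside `L²(X, μ)`. -/
def standardSubspace (μ : Measure X) (E : Set X) : Submodule ℂ (Lp ℂ 2 μ) where
  carrier := {f | ∀ᵐ x ∂μ, x ∉ E → f x = 0}
  zero_mem' := by
    filter_upwards [Lp.coeFn_zero ℂ 2 μ] with x hx _
    exact hx
  add_mem' := by
    intro f g hf hg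
    filter_upwards [hf, hg, Lp.coeFn_add f g] with x h1 h2 h3 hx
    rw [h3, Pi.add_apply, h1 hx, h2 hx, add_zero]
  smul_mem' := by
    intro c f hf
    filter_upwards [hf, Lp.coeFn_smul c f] with x h1 h3 hx
    rw [h3, Pi.smul_apply, h1 hx, smul_zero]

/-- The class of `χ_E f` in `L²(X, μ)`. -/
def restrictFun (μ : Measure X) {E : Set X} (hE : MeasurableSet E) (f : Lp ℂ 2 μ) : Lp ℂ 2 μ :=
  ((Lp.memLp f).indicator hE).toLp (E.indicator f)

theorem restrictFun_coeFn (μ : Measure X) {E : Set X} (hE : MeasurableSet E) (f : Lp ℂ 2 μ) :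
    restrictFun μ hE f =ᵐ[μ] E.indicator f := by
  rw [restrictFun]
  exact MemLp.coeFn_toLp _

theorem restrictFun_add (μ : Measure X) {E : Set X} (hE : MeasurableSet E) (f g : Lp ℂ 2 μ) :
    restrictFun μ hE (f + g) = restrictFun μ hE f + restrictFun μ hE g := by
  apply Lp.ext
  filter_upwards [restrictFun_coeFn μ hE (f + g), restrictFun_coeFn μ hE f,
    restrictFun_coeFn μ hE g, Lp.coeFn_add f g,
    Lp.coeFn_add (restrictFun μ hE f) (restrictFun μ hE g)] with x h1 h2 h3 h4 h5
  rw [h1, h5, Pi.add_apply, h2, h3]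
  by_cases hx : x ∈ E
  · rw [Set.indicator_of_mem hx, Set.indicator_of_mem hx, Set.indicator_of_mem hx, h4,
      Pi.add_apply]
  · rw [Set.indicator_of_notMem hx, Set.indicator_of_notMem hx, Set.indicator_of_notMem hx,
      add_zero]

theorem restrictFun_smul (μ : Measure X) {E : Set X} (hE : MeasurableSet E) (c : ℂ)
    (f : Lp ℂ 2 μ) : restrictFun μ hE (c • f) = c • restrictFun μ hE f := by
  apply Lp.ext
  filter_upwards [restrictFun_coeFn μ hE (c • f), restrictFun_coeFn μ hE f, Lp.coeFn_smul c f,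
    Lp.coeFn_smul c (restrictFun μ hE f)] with x h1 h2 h3 h4
  rw [h1, h4, Pi.smul_apply, h2]
  by_cases hx : x ∈ E
  · rw [Set.indicator_of_mem hx, Set.indicator_of_mem hx, h3, Pi.smul_apply]
  · rw [Set.indicator_of_notMem hx, Set.indicator_of_notMem hx, smul_zero]

theorem norm_restrictFun_le (μ : Measure X) {E : Set X} (hE : MeasurableSet E) (f : Lp ℂ 2 μ) :
    ‖restrictFun μ hE f‖ ≤ 1 * ‖f‖ := by
  rw [one_mul, restrictFun, Lp.norm_toLp, Lp.norm_def]
  exact ENNReal.toReal_mono (Lp.eLpNorm_ne_top f) (eLpNorm_indicator_le _)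

/-- The standard projection attached to the measurable set `E`: multiplication by the
characteristic function of `E`. -/
def standardProjection (μ : Measure X) {E : Set X} (hE : MeasurableSet E) :
    Lp ℂ 2 μ →L[ℂ] Lp ℂ 2 μ :=
  LinearMap.mkContinuous
    { toFun := restrictFun μ hE
      map_add' := restrictFun_add μ hE
      map_smul' := restrictFun_smul μ hE }
    1 (norm_restrictFun_le μ hE)

theorem standardProjection_coeFn (μ : Measure X) {E : Set X} (hE : MeasurableSet E)
    (f : Lp ℂ 2 μ) : standardProjection μ hE f =ᵐ[μ] E.indicator f :=
  restrictFun_coeFn μ hE f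

theorem standardProjection_mem (μ : Measure X) {E : Set X} (hE : MeasurableSet E)
    (f : Lp ℂ 2 μ) : standardProjection μ hE f ∈ standardSubspace μ E := by
  change ∀ᵐ x ∂μ, x ∉ E → standardProjection μ hE f x = 0
  filter_upwards [standardProjection_coeFn μ hE f] with x h hx
  rw [h, Set.indicator_of_notMem hx]

/-- The block `P_E T |_{ran P_F} : L²(F) → L²(E)` of the operator `T`. -/
def block {μ : Measure X} (T : Lp ℂ 2 μ →L[ℂ] Lp ℂ 2 μ) {E : Set X} (hE : MeasurableSet E)
    (F : Set X) : standardSubspace μ F →L[ℂ] standardSubspace μ E :=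
  ((standardProjection μ hE).codRestrict (standardSubspace μ E)
    (standardProjection_mem μ hE)).comp (T.comp (standardSubspace μ F).subtypeL)

/-- The compression `P_E T |_{ran P_E}` of `T` to the standard subspace of `E`. -/
def compression {μ : Measure X} (T : Lp ℂ 2 μ →L[ℂ] Lp ℂ 2 μ) {E : Set X}
    (hE : MeasurableSet E) : standardSubspace μ E →L[ℂ] standardSubspace μ E :=
  block T hE E

/-- `T` has increasing spectrum relative to standard compressions. -/
def HasIncreasingSpectrum {μ : Measure X} (T : Lp ℂ 2 μ →L[ℂ] Lp ℂ 2 μ) : Prop :=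
  ∀ (E F : Set X) (hE : MeasurableSet E) (hF : MeasurableSet F),
    standardSubspace μ E ≤ standardSubspace μ F →
      spectrum ℂ (compression T hE) ⊆ spectrum ℂ (compression T hF)

/-- The operator `P` is a standard projection. -/
def IsStandardProjection {μ : Measure X} (P : Lp ℂ 2 μ →L[ℂ] Lp ℂ 2 μ) : Prop :=
  ∃ (E : Set X) (hE : MeasurableSet E), P = standardProjection μ hE

/-- The algebra `M^∞(X, μ)` of multiplication operators by `L^∞` functions, as a set of
operators. -/
def multiplicationOperators (μ : Measure X) : Set (Lp ℂ 2 μ →L[ℂ] Lp ℂ 2 μ) :=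
  {A | ∃ φ : Lp ℂ ∞ μ, ∀ f : Lp ℂ 2 μ, A f =ᵐ[μ] fun x => φ x * f x}

/-- The set `Λ` of standard projections (a family indexed by itself) is a standard triangularization of
`T`: the ranges are invariant under `T`, they are totally ordered by inclusion, and they form a
maximal totally ordered family among all families of standard subspaces. -/
structure IsStandardTriangularization {μ : Measure X} (T : Lp ℂ 2 μ →L[ℂ] Lp ℂ 2 μ)
    (Λ : Set (Lp ℂ 2 μ →L[ℂ] Lp ℂ 2 μ)) : Prop where
  standard : ∀ P ∈ Λ, IsStandardProjection P
  invariant : ∀ P ∈ Λ, ∀ f ∈ LinearMap.range P.toLinearMap, T f ∈ LinearMap.range P.toLinearMap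
  chain : ∀ P ∈ Λ, ∀ Q ∈ Λ,
    LinearMap.range P.toLinearMap ≤ LinearMap.range Q.toLinearMap ∨
      LinearMap.range Q.toLinearMap ≤ LinearMap.range P.toLinearMap
  maximal : ∀ Q : Lp ℂ 2 μ →L[ℂ] Lp ℂ 2 μ, IsStandardProjection Q →
    (∀ P ∈ Λ, LinearMap.range P.toLinearMap ≤ LinearMap.range Q.toLinearMap ∨
      LinearMap.range Q.toLinearMap ≤ LinearMap.range P.toLinearMap) → Q ∈ Λ

/-- `T` admits a multiplicity-free standard triangularization: the closed linear span of the
projections in the weak operator topology is `M^∞(X, μ)`. -/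
def AdmitsMultiplicityFreeTriangularization {μ : Measure X}
    (T : Lp ℂ 2 μ →L[ℂ] Lp ℂ 2 μ) : Prop :=
  ∃ Λ : Set (Lp ℂ 2 μ →L[ℂ] Lp ℂ 2 μ), IsStandardTriangularization T Λ ∧
    closure (Submodule.span ℂ (ContinuousLinearMapWOT.ofCLM '' Λ) :
        Set (Lp ℂ 2 μ →WOT[ℂ] Lp ℂ 2 μ)) =
      ContinuousLinearMapWOT.ofCLM '' multiplicationOperators μ

end StdTri

end

open scoped Matrix Topology

noncomputable section

namespace StdTri

variable {X : Type*} [MeasurableSpace X] {μ : Measure X}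

/-! Write `K h = ∑ i, ⟪v i, h⟫ u i` and attach to each point `x` its type `(u x, conj (v x))` in `ℂⁿ
× ℂⁿ`, so that `K` has integral kernel `kern (type x) (type y)`. Away from zero, the spectrum of the
compression to `E` is that of the `n × n` matrix `gram u v E` (`mem_spectrum_compression_iff`), an
integral over `E` of rank one matrices and hence additive in `E`. Increasing spectrum confines these
eigenvalues to one finite set, so for each `k > 0` the trace of `gram u v E ^ k` takes only finitely
many values as `E` varies (`finite_trace_gram_pow`).

On the essential range of the types, draw an edge `p → q` when `p ≠ q` and `kern p q ≠ 0`. The heart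
of the proof is that this graph has no cycle (`not_hasPeriodicWalk`). A shortest cycle has no
chords. If one of its types occurs on sets of arbitrarily small measure, adding such a set cannot
change a finitely valued trace; polarizing and passing to the limit, a symmetrized trace of rank one
matrices vanishes, while on a chordless cycle it is a positive multiple of the product of the edge
weights. If no type occurs on such small sets, each is carried by an atom, and on the union of these
atoms the diagonal eigenvalue of one atom cannot survive as an eigenvalue. Moreover the fibre of a
type with `kern p p ≠ 0` is an atom (`isAtomOf_preimage_of_loop`).

An acyclic kernel of rank at most `n` can be sorted into at most `2n + 1` levels by peeling off, in
turn, the zero columns and single loops, each loop lowering the rank (`exists_isLevelFunction`). A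
level containing a loop consists of that single type, so its diagonal block is one-dimensional; the
other diagonal blocks vanish. This is the block form.

For the triangularization, the levels are refined to a real function `H` that separates measurable
sets modulo null sets. The sets `{H < t}` form a chain passing through all `{level < k}`; extend it
to a maximal chain of standard subspaces. Any member is trapped between two consecutive levels and
is therefore automatically invariant. Since `H` separates sets, the projections of the chain
generate every standard projection, hence all of `M^∞`. -/

theorem mem_standardSubspace {E : Set X} {f : Lp ℂ 2 μ} :
    f ∈ standardSubspace μ E ↔ ∀ᵐ x ∂μ, x ∉ E → f x = 0 := Iff.rfl

theorem standardProjection_eq_self {E : Set X} (hE : MeasurableSet E) {f : Lp ℂ 2 μ}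
    (hf : f ∈ standardSubspace μ E) : standardProjection μ hE f = f := by
  apply Lp.ext
  filter_upwards [standardProjection_coeFn μ hE f, mem_standardSubspace.1 hf] with x h1 h2
  rw [h1]
  by_cases hx : x ∈ E
  · rw [Set.indicator_of_mem hx]
  · rw [Set.indicator_of_notMem hx, h2 hx]

theorem range_standardProjection {E : Set X} (hE : MeasurableSet E) :
    LinearMap.range (standardProjection μ hE).toLinearMap = standardSubspace μ E := by
  ext f
  constructor
  · rintro ⟨g, rfl⟩
    exact standardProjection_mem μ hE g
  · intro hf
    exact ⟨f, standardProjection_eq_self hE hf⟩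

theorem inner_standardProjection {E : Set X} (hE : MeasurableSet E) (f g : Lp ℂ 2 μ) :
    inner ℂ f (standardProjection μ hE g) = ∫ x in E, inner ℂ (f x) (g x) ∂μ := by
  rw [L2.inner_def, ← integral_indicator hE]
  apply integral_congr_ae
  filter_upwards [standardProjection_coeFn μ hE g] with x h1
  rw [h1]
  by_cases hx : x ∈ E
  · simp [hx]
  · simp [hx]

theorem standardSubspace_univ : standardSubspace μ (Set.univ : Set X) = ⊤ := by
  rw [eq_top_iff]
  intro f _
  exact mem_standardSubspace.2 (Eventually.of_forall fun x hx => absurd (Set.mem_univ x) hx)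

theorem standardSubspace_empty : standardSubspace μ (∅ : Set X) = ⊥ := by
  rw [eq_bot_iff]
  intro f hf
  rw [Submodule.mem_bot, Lp.eq_zero_iff_ae_eq_zero]
  filter_upwards [mem_standardSubspace.1 hf] with x hx
  exact hx (Set.notMem_empty x)

/-! ### The σ-finite carrier -/

/-- A set outside of which every square-integrable function vanishes, and on which the measure is
`σ`-finite. -/
structure IsCarrier (μ : Measure X) (S : Set X) : Prop where
  measurableSet : MeasurableSet S
  sigmaFinite : SigmaFinite (μ.restrict S)
  vanish : ∀ f : Lp ℂ 2 μ, ∀ᵐ x ∂μ, x ∉ S → f x = 0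

/-- The carrier is the union of the sets `{‖d k‖ ≥ 1/(j+1)}` over a dense sequence `d`. Each has
finite measure by Chebyshev, and vanishing off the union is a closed condition satisfied by every `d
k`. -/
theorem exists_isCarrier [TopologicalSpace.SeparableSpace (Lp ℂ 2 μ)] :
    ∃ S : Set X, IsCarrier μ S := by
  let d : ℕ → Lp ℂ 2 μ := TopologicalSpace.denseSeq _
  have hdm : ∀ k, Measurable (d k) := fun k => (Lp.stronglyMeasurable (d k)).measurable
  let A : ℕ × ℕ → Set X := fun i => {x | 1 / ((i.2 : ℝ) + 1) ≤ ‖d i.1 x‖}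
  have hA : ∀ i, MeasurableSet (A i) := fun i =>
    measurableSet_le measurable_const (hdm i.1).norm
  have hAfin : ∀ i, μ (A i) < ∞ := by
    intro i
    have hpos : (0 : ℝ) < 1 / ((i.2 : ℝ) + 1) := by positivity
    have h := (Lp.memLp (d i.1)).meas_ge_lt_top (by norm_num) (by norm_num)
      (ε := ⟨1 / ((i.2 : ℝ) + 1), hpos.le⟩) (by
        intro h0; exact hpos.ne' (congrArg NNReal.toReal h0))
    exact h
  refine ⟨⋃ i, A i, MeasurableSet.iUnion hA, ?_, ?_⟩
  · refine ⟨⟨?_⟩⟩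
    -- The complement of the carrier is null for the restricted measure; adjoining it to every set
    -- makes the sequence cover the whole space.
    refine ⟨fun k => A ((Encodable.decode k).getD (0, 0)) ∪ (⋃ i, A i)ᶜ, fun _ => trivial, ?_, ?_⟩
    · intro k
      rw [Measure.restrict_apply ((hA _).union (MeasurableSet.iUnion hA).compl)]
      refine lt_of_le_of_lt (measure_mono ?_) (hAfin ((Encodable.decode k).getD (0, 0)))
      rintro x ⟨h1 | h1, h2⟩
      · exact h1
      · exact absurd h2 h1
    · rw [Set.eq_univ_iff_forall]
      intro x
      by_cases hx : x ∈ ⋃ i, A i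
      · obtain ⟨i, hi⟩ := Set.mem_iUnion.1 hx
        refine Set.mem_iUnion.2 ⟨Encodable.encode i, Or.inl ?_⟩
        rw [Encodable.encodek]
        exact hi
      · exact Set.mem_iUnion.2 ⟨0, Or.inr hx⟩
  · intro f
    have hcl : IsClosed {g : Lp ℂ 2 μ | standardProjection μ (MeasurableSet.iUnion hA).compl g = 0} :=
      isClosed_eq (standardProjection μ _).continuous continuous_const
    have hf : f ∈ {g : Lp ℂ 2 μ |
        standardProjection μ (MeasurableSet.iUnion hA).compl g = 0} := by
      refine hcl.closure_subset_iff.2 ?_ (TopologicalSpace.denseRange_denseSeq (Lp ℂ 2 μ) f)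
      rintro _ ⟨k, rfl⟩
      refine (Lp.eq_zero_iff_ae_eq_zero).2 ?_
      filter_upwards [standardProjection_coeFn μ (MeasurableSet.iUnion hA).compl (d k)]
        with x hx
      change (standardProjection μ (MeasurableSet.iUnion hA).compl (d k)) x = 0
      rw [hx]
      by_cases hxS : x ∈ (⋃ i, A i)ᶜ
      · rw [Set.indicator_of_mem hxS]
        by_contra hne
        obtain ⟨j, hj⟩ := exists_nat_one_div_lt (norm_pos_iff.2 hne)
        exact hxS (Set.mem_iUnion.2 ⟨(k, j), hj.le⟩)
      · rw [Set.indicator_of_notMem hxS]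
    filter_upwards [standardProjection_coeFn μ (MeasurableSet.iUnion hA).compl f,
      (Lp.eq_zero_iff_ae_eq_zero).1 hf] with x h1 h2 hx
    rw [h2, Set.indicator_of_mem hx] at h1
    exact h1.symm

namespace IsCarrier

variable {S : Set X}

theorem exists_finite_subset (hS : IsCarrier μ S) {A : Set X} (hA : MeasurableSet A)
    (h : μ.restrict S A ≠ 0) :
    ∃ B ⊆ A ∩ S, MeasurableSet B ∧ μ B ≠ 0 ∧ μ B ≠ ∞ := by
  have := hS.sigmaFinite
  obtain ⟨t, ht, hts, h0, h1⟩ := Measure.exists_subset_measure_lt_top hA (pos_iff_ne_zero.2 h)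
  rw [Measure.restrict_apply ht] at h0 h1
  exact ⟨t ∩ S, Set.inter_subset_inter_left _ hts, ht.inter hS.measurableSet, h0.ne', h1.ne⟩

theorem standardSubspace_le_iff (hS : IsCarrier μ S) {E F : Set X} (hE : MeasurableSet E)
    (hF : MeasurableSet F) :
    standardSubspace μ E ≤ standardSubspace μ F ↔ μ.restrict S (E \ F) = 0 := by
  constructor
  · intro h
    by_contra hne
    obtain ⟨B, hBs, hB, hB0, hB1⟩ := hS.exists_finite_subset (hE.diff hF) hne
    have hmem : indicatorConstLp 2 hB hB1 (1 : ℂ) ∈ standardSubspace μ E := by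
      filter_upwards [indicatorConstLp_coeFn (p := 2) (hs := hB) (hμs := hB1) (c := (1 : ℂ))]
        with x hx hxE
      rw [hx, Set.indicator_of_notMem]
      exact fun hxB => hxE (hBs hxB).1.1
    have hmem' := mem_standardSubspace.1 (h hmem)
    apply hB0
    have : ∀ᵐ x ∂μ, x ∉ B := by
      filter_upwards [hmem',
        indicatorConstLp_coeFn (p := 2) (hs := hB) (hμs := hB1) (c := (1 : ℂ))] with x h1 h2 hxB
      have := h1 (hBs hxB).1.2
      rw [h2, Set.indicator_of_mem hxB] at this
      exact one_ne_zero this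
    exact measure_eq_zero_iff_ae_notMem.2 this
  · intro h f hf
    have h' : ∀ᵐ x ∂μ, x ∈ S → x ∉ E \ F :=
      (ae_restrict_iff' hS.measurableSet).1 (measure_eq_zero_iff_ae_notMem.1 h)
    filter_upwards [mem_standardSubspace.1 hf, hS.vanish f, h'] with x h1 h2 h3 hxF
    by_cases hxS : x ∈ S
    · exact h1 fun hxE => h3 hxS ⟨hxE, hxF⟩
    · exact h2 hxS

theorem standardSubspace_eq_bot_iff (hS : IsCarrier μ S) {E : Set X} (hE : MeasurableSet E) :
    standardSubspace μ E = ⊥ ↔ μ.restrict S E = 0 := by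
  rw [eq_bot_iff, ← standardSubspace_empty, hS.standardSubspace_le_iff hE MeasurableSet.empty,
    Set.sdiff_empty]

end IsCarrier

/-! ### Atoms -/

/-- The measurable set `a` is an atom of `ν`. -/
structure IsAtomOf (ν : Measure X) (a : Set X) : Prop where
  measurableSet : MeasurableSet a
  ne_zero : ν a ≠ 0
  dichotomy : ∀ B ⊆ a, MeasurableSet B → ν B = 0 ∨ ν (a \ B) = 0

/-- Two distinct points in the support of the pushed-forward measure would have disjoint
neighbourhoods, whose preimages would split the atom. -/
theorem IsAtomOf.ae_eq_const {ν : Measure X} {a : Set X} (ha : IsAtomOf ν a) {Y : Type*}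
    [TopologicalSpace Y] [T2Space Y] [SecondCountableTopology Y] [MeasurableSpace Y]
    [OpensMeasurableSpace Y] {f : X → Y} (hf : Measurable f) :
    ∃ c, ∀ᵐ x ∂ν, x ∈ a → f x = c := by
  have hne : (ν.restrict a).map f ≠ 0 := by
    intro h0
    have := congrArg (fun ρ : Measure Y => ρ Set.univ) h0
    simp [Measure.map_apply hf MeasurableSet.univ] at this
    exact ha.ne_zero this
  obtain ⟨c, hc⟩ := Measure.nonempty_support hne
  refine ⟨c, (ae_restrict_iff' ha.measurableSet).1 ?_⟩
  filter_upwards [ae_of_ae_map hf.aemeasurable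
    (Measure.support_mem_ae (μ := (ν.restrict a).map f))] with x hx
  by_contra hxc
  obtain ⟨U, V, hU, hV, hxU, hcV, hUV⟩ := t2_separation hxc
  have h1 := (Measure.mem_support_iff_forall _).1 hx U (hU.mem_nhds hxU)
  have h2 := (Measure.mem_support_iff_forall _).1 hc V (hV.mem_nhds hcV)
  rw [Measure.map_apply hf hU.measurableSet, Measure.restrict_apply (hf hU.measurableSet)] at h1
  rw [Measure.map_apply hf hV.measurableSet, Measure.restrict_apply (hf hV.measurableSet)] at h2
  rcases ha.dichotomy (f ⁻¹' U ∩ a) Set.inter_subset_right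
    ((hf hU.measurableSet).inter ha.measurableSet) with h | h
  · exact h1.ne' h
  · refine h2.ne' (measure_mono_null ?_ h)
    rintro y ⟨hy1, hy2⟩
    exact ⟨hy2, fun hy3 => Set.disjoint_left.1 hUV hy3.1 hy1⟩

theorem IsAtomOf.finrank_eq_one {S a : Set X} (hS : IsCarrier μ S)
    (ha : IsAtomOf (μ.restrict S) a) : Module.finrank ℂ (standardSubspace μ a) = 1 := by
  have hne : standardSubspace μ a ≠ ⊥ := fun h =>
    ha.ne_zero ((hS.standardSubspace_eq_bot_iff ha.measurableSet).1 h)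
  have hconst : ∀ f ∈ standardSubspace μ a, ∃ c : ℂ, ∀ᵐ x ∂μ, x ∈ S → x ∈ a → f x = c := by
    intro f _
    obtain ⟨c, hc⟩ := ha.ae_eq_const (Lp.stronglyMeasurable f).measurable
    exact ⟨c, (ae_restrict_iff' hS.measurableSet).1 hc⟩
  obtain ⟨f₀, hf₀, hf₀0⟩ := Submodule.exists_mem_ne_zero_of_ne_bot hne
  obtain ⟨c₀, hc₀⟩ := hconst f₀ hf₀
  have hc₀0 : c₀ ≠ 0 := by
    rintro rfl
    apply hf₀0
    rw [Lp.eq_zero_iff_ae_eq_zero]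
    filter_upwards [hc₀, hS.vanish f₀, mem_standardSubspace.1 hf₀] with x h1 h2 h3
    by_cases hxS : x ∈ S
    · by_cases hxa : x ∈ a
      · exact h1 hxS hxa
      · exact h3 hxa
    · exact h2 hxS
  refine finrank_eq_one_iff'.2 ⟨⟨f₀, hf₀⟩, fun h => hf₀0 (congrArg Subtype.val h), ?_⟩
  rintro ⟨f, hf⟩
  obtain ⟨c, hc⟩ := hconst f hf
  refine ⟨c / c₀, Subtype.ext ?_⟩
  change (c / c₀) • f₀ = f
  apply Lp.ext
  filter_upwards [hc₀, hc, hS.vanish f₀, hS.vanish f, mem_standardSubspace.1 hf₀,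
    mem_standardSubspace.1 hf, Lp.coeFn_smul (c / c₀) f₀] with x h1 h2 h3 h4 h5 h6 h7
  rw [h7, Pi.smul_apply, smul_eq_mul]
  by_cases hxS : x ∈ S
  · by_cases hxa : x ∈ a
    · rw [h1 hxS hxa, h2 hxS hxa, div_mul_cancel₀ _ hc₀0]
    · rw [h5 hxa, h6 hxa, mul_zero]
  · rw [h3 hxS, h4 hxS, mul_zero]

/-! ### Finite rank kernels and Gram matrices -/

theorem exists_finite_rank_representation {n : ℕ} {K : Lp ℂ 2 μ →L[ℂ] Lp ℂ 2 μ}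
    (hrank : LinearMap.rank K.toLinearMap = n) :
    ∃ u v : Fin n → Lp ℂ 2 μ, ∀ h, K h = ∑ i, inner ℂ (v i) h • u i := by
  have hfin : FiniteDimensional ℂ (LinearMap.range K.toLinearMap) :=
    Module.rank_lt_aleph0_iff.1 (by
      change LinearMap.rank K.toLinearMap < _
      rw [hrank]; exact Cardinal.natCast_lt_aleph0)
  have hdim : Module.finrank ℂ (LinearMap.range K.toLinearMap) = n :=
    Module.finrank_eq_of_rank_eq hrank
  let b := (stdOrthonormalBasis ℂ (LinearMap.range K.toLinearMap)).reindex (finCongr hdim)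
  refine ⟨fun i => (b i : Lp ℂ 2 μ), fun i => K.adjoint (b i : Lp ℂ 2 μ), fun h => ?_⟩
  have h1 := b.sum_repr' ⟨K h, LinearMap.mem_range_self K.toLinearMap h⟩
  have h2 := congrArg (Subtype.val) h1
  rw [Submodule.coe_sum] at h2
  refine h2.symm.trans ?_
  refine Finset.sum_congr rfl fun i _ => ?_
  rw [ContinuousLinearMap.adjoint_inner_left]
  rfl

/-- Pairs of vectors, the values taken by the two factors of a kernel of rank at most `n`. -/
abbrev KernelType (n : ℕ) : Type := (Fin n → ℂ) × (Fin n → ℂ)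

/-- The pairing of two kernel types. -/
def kern {n : ℕ} (p q : KernelType n) : ℂ := p.1 ⬝ᵥ q.2

/-- The rank one matrix attached to a kernel type. -/
def typeMatrix {n : ℕ} (p : KernelType n) : Matrix (Fin n) (Fin n) ℂ :=
  Matrix.vecMulVec p.2 p.1

/-- The kernel type of a point: the kernel of `h ↦ ∑ i, ⟪v i, h⟫ u i` at `(x, y)` is the pairing of
the types of `x` and `y`. -/
def typeMap {n : ℕ} (u v : Fin n → Lp ℂ 2 μ) (x : X) : KernelType n :=
  (fun i => u i x, fun i => star (v i x))

/-- The matrix of the compression of `h ↦ ∑ i, ⟪v i, h⟫ u i` to the standard subspace of `E`. -/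
def gram {n : ℕ} (u v : Fin n → Lp ℂ 2 μ) (E : Set X) : Matrix (Fin n) (Fin n) ℂ :=
  Matrix.of fun i j => ∫ x in E, typeMatrix (typeMap u v x) i j ∂μ

variable {n : ℕ} {u v : Fin n → Lp ℂ 2 μ}

theorem measurable_typeMap : Measurable (typeMap u v) := by
  refine Measurable.prodMk (measurable_pi_lambda _ fun i => ?_) (measurable_pi_lambda _ fun i => ?_)
  · exact (Lp.stronglyMeasurable (u i)).measurable
  · exact continuous_star.measurable.comp (Lp.stronglyMeasurable (v i)).measurable

theorem continuous_kern : Continuous fun r : KernelType n × KernelType n => kern r.1 r.2 := by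
  unfold kern dotProduct
  fun_prop

theorem continuous_typeMatrix_apply (i j : Fin n) :
    Continuous fun p : KernelType n => typeMatrix p i j := by
  unfold typeMatrix Matrix.vecMulVec
  simp only [Matrix.of_apply]
  fun_prop

theorem trace_typeMatrix (p : KernelType n) : (typeMatrix p).trace = kern p p := by
  unfold typeMatrix kern
  rw [Matrix.trace_vecMulVec, dotProduct_comm]

theorem typeMatrix_typeMap_apply (x : X) (i j : Fin n) :
    typeMatrix (typeMap u v x) i j = inner ℂ (v i x) (u j x) := by
  simp [typeMatrix, typeMap, Matrix.vecMulVec, RCLike.inner_apply, mul_comm]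

theorem integrable_typeMatrix (i j : Fin n) :
    Integrable (fun x => typeMatrix (typeMap u v x) i j) μ := by
  simp_rw [typeMatrix_typeMap_apply]
  exact L2.integrable_inner (v i) (u j)

theorem gram_apply {E : Set X} (hE : MeasurableSet E) (i j : Fin n) :
    gram u v E i j = inner ℂ (v i) (standardProjection μ hE (u j)) := by
  rw [inner_standardProjection]
  simp only [gram, Matrix.of_apply, typeMatrix_typeMap_apply]

theorem gram_mulVec {E : Set X} (hE : MeasurableSet E) (z : Fin n → ℂ) (i : Fin n) :
    (gram u v E *ᵥ z) i = inner ℂ (v i) (standardProjection μ hE (∑ j, z j • u j)) := by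
  simp only [Matrix.mulVec, dotProduct, map_sum, map_smul, inner_sum, inner_smul_right,
    gram_apply hE, mul_comm]

theorem gram_biUnion {ι : Type*} (s : Finset ι) {B : ι → Set X} (hB : ∀ i, MeasurableSet (B i))
    (h : Pairwise fun i j => Disjoint (B i) (B j)) :
    gram u v (⋃ i ∈ s, B i) = ∑ i ∈ s, gram u v (B i) := by
  ext a b
  rw [Matrix.sum_apply]
  exact integral_biUnion_finset s (fun i _ => hB i) (fun i _ j _ hij => h hij)
    (fun i _ => (integrable_typeMatrix a b).integrableOn)

theorem matrix_mem_spectrum_iff (G : Matrix (Fin n) (Fin n) ℂ) (c : ℂ) :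
    c ∈ spectrum ℂ G ↔ ∃ z ≠ 0, G *ᵥ z = c • z := by
  rw [spectrum.mem_iff, Matrix.isUnit_iff_isUnit_det, isUnit_iff_ne_zero, not_not,
    ← Matrix.exists_mulVec_eq_zero_iff]
  refine exists_congr fun z => and_congr_right fun _ => ?_
  rw [Matrix.sub_mulVec, sub_eq_zero, Matrix.algebraMap_eq_diagonal, eq_comm]
  have : Matrix.diagonal (algebraMap ℂ (Fin n → ℂ) c) *ᵥ z = c • z := by
    ext i
    simp [Matrix.mulVec_diagonal]
  rw [this]

variable {K : Lp ℂ 2 μ →L[ℂ] Lp ℂ 2 μ}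

theorem isCompactOperator_of_representation (hrep : ∀ h, K h = ∑ i, inner ℂ (v i) h • u i) :
    IsCompactOperator K := by
  let U : (Fin n → ℂ) →L[ℂ] Lp ℂ 2 μ :=
    ∑ i, (ContinuousLinearMap.proj (R := ℂ) (φ := fun _ : Fin n => ℂ) i).smulRight (u i)
  let V : Lp ℂ 2 μ →L[ℂ] (Fin n → ℂ) := ContinuousLinearMap.pi fun i => innerSL ℂ (v i)
  have hUV : (K : Lp ℂ 2 μ → Lp ℂ 2 μ) = U ∘ V := by
    funext h
    rw [hrep h]
    simp [U, V]
  rw [hUV]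
  exact (isCompactOperator_of_locallyCompactSpace_rng U).comp_clm V

theorem isClosed_standardSubspace {E : Set X} (hE : MeasurableSet E) :
    IsClosed (standardSubspace μ E : Set (Lp ℂ 2 μ)) := by
  have : (standardSubspace μ E : Set (Lp ℂ 2 μ)) = {f | standardProjection μ hE f = f} := by
    ext f
    exact ⟨fun hf => standardProjection_eq_self hE hf,
      fun hf => hf ▸ standardProjection_mem μ hE f⟩
  rw [this]
  exact isClosed_eq (standardProjection μ hE).continuous continuous_id

theorem mem_spectrum_compression_iff_exists_eigenvector
    (hrep : ∀ h, K h = ∑ i, inner ℂ (v i) h • u i)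
    {E : Set X} (hE : MeasurableSet E) {c : ℂ} (hc : c ≠ 0) :
    c ∈ spectrum ℂ (compression K hE) ↔
      ∃ h ∈ standardSubspace μ E, h ≠ 0 ∧ standardProjection μ hE (K h) = c • h := by
  have hcomp : CompleteSpace (standardSubspace μ E) :=
    (isClosed_standardSubspace hE).completeSpace_coe
  have hcpt : IsCompactOperator (compression K hE) :=
    ((isCompactOperator_of_representation hrep).comp_clm (standardSubspace μ E).subtypeL).clm_comp
      ((standardProjection μ hE).codRestrict (standardSubspace μ E) (standardProjection_mem μ hE))
  rw [← hcpt.hasEigenvalue_iff_mem_spectrum hc]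
  constructor
  · intro h
    obtain ⟨x, hx⟩ := h.exists_hasEigenvector
    exact ⟨x, x.2, fun h0 => hx.2 (Subtype.ext h0), congrArg Subtype.val hx.apply_eq_smul⟩
  · rintro ⟨h, hh, h0, heq⟩
    exact Module.End.hasEigenvalue_of_hasEigenvector (x := ⟨h, hh⟩)
      ⟨Module.End.mem_eigenspace_iff.2 (Subtype.ext heq), fun h1 => h0 (congrArg Subtype.val h1)⟩

/-- This is the coincidence of the non-zero spectra of `AB` and `BA`: eigenvectors correspond
through `h ↦ (⟪v i, h⟫)` and `z ↦ P_E (∑ j, z j • u j)`. -/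
theorem mem_spectrum_compression_iff (hrep : ∀ h, K h = ∑ i, inner ℂ (v i) h • u i)
    {E : Set X} (hE : MeasurableSet E) {c : ℂ} (hc : c ≠ 0) :
    c ∈ spectrum ℂ (compression K hE) ↔ c ∈ spectrum ℂ (gram u v E) := by
  rw [mem_spectrum_compression_iff_exists_eigenvector hrep hE hc, matrix_mem_spectrum_iff]
  constructor
  · rintro ⟨h, hh, h0, heq⟩
    refine ⟨fun i => inner ℂ (v i) h, ?_, ?_⟩
    · intro hz
      apply h0
      have : K h = 0 := by
        rw [hrep h]
        exact Finset.sum_eq_zero fun i _ => by rw [show inner ℂ (v i) h = 0 from congrFun hz i,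
          zero_smul]
      rw [this, map_zero] at heq
      exact (smul_eq_zero.1 heq.symm).resolve_left hc
    · ext i
      rw [gram_mulVec hE, ← hrep h, heq, inner_smul_right]
      rfl
  · rintro ⟨z, hz, heq⟩
    have hin : ∀ i, inner ℂ (v i) (standardProjection μ hE (∑ j, z j • u j)) = c * z i := by
      intro i
      rw [← gram_mulVec hE, heq]
      rfl
    refine ⟨standardProjection μ hE (∑ j, z j • u j), standardProjection_mem μ hE _, ?_, ?_⟩
    · intro h0
      apply hz
      ext i
      have := hin i
      rw [h0, inner_zero_right] at this
      exact (mul_eq_zero.1 this.symm).resolve_left hc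
    · rw [hrep]
      simp_rw [hin, mul_smul]
      rw [← Finset.smul_sum, map_smul]

theorem spectrum_compression_subset_univ (hinc : HasIncreasingSpectrum K) {E : Set X}
    (hE : MeasurableSet E) :
    spectrum ℂ (compression K hE) ⊆ spectrum ℂ (compression K MeasurableSet.univ) :=
  hinc E Set.univ hE MeasurableSet.univ (standardSubspace_univ (μ := μ) ▸ le_top)

theorem hasEigenvalue_of_mem_spectrum_compression
    (hrep : ∀ h, K h = ∑ i, inner ℂ (v i) h • u i) (hinc : HasIncreasingSpectrum K)
    {E : Set X} (hE : MeasurableSet E) {c : ℂ} (hc : c ≠ 0)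
    (h : c ∈ spectrum ℂ (compression K hE)) : Module.End.HasEigenvalue K.toLinearMap c := by
  obtain ⟨f, -, hf0, hf⟩ := (mem_spectrum_compression_iff_exists_eigenvector hrep
    MeasurableSet.univ hc).1 (spectrum_compression_subset_univ hinc hE h)
  rw [standardProjection_eq_self MeasurableSet.univ
    (standardSubspace_univ (μ := μ) ▸ Submodule.mem_top)] at hf
  exact Module.End.hasEigenvalue_of_hasEigenvector (x := f)
      ⟨Module.End.mem_eigenspace_iff.2 hf, hf0⟩

theorem finite_sums_of_finite {F : Set ℂ} (hF : F.Finite) (n : ℕ) :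
    {t : ℂ | ∃ s : Multiset ℂ, s.card = n ∧ (∀ x ∈ s, x ∈ F) ∧ s.sum = t}.Finite := by
  have := hF.to_subtype
  refine (Set.finite_range fun f : Fin n → F => ∑ i, (f i : ℂ)).subset ?_
  rintro t ⟨s, hs, hsF, rfl⟩
  induction s using Quotient.inductionOn with
  | h l =>
    have hl : l.length = n := hs
    subst hl
    refine ⟨fun i => ⟨l.get i, hsF _ (List.get_mem l i)⟩, ?_⟩
    simp [← List.sum_ofFn]

/-- The trace is a sum of `n` eigenvalues with multiplicity, each the `k`-th power of an eigenvalue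
of `gram u v E`. The latter is zero or, by monotonicity, lies in the finite spectrum attached to the
whole space. -/
theorem finite_trace_gram_pow (hrep : ∀ h, K h = ∑ i, inner ℂ (v i) h • u i)
    (hinc : HasIncreasingSpectrum K) {k : ℕ} (hk : 0 < k) :
    {t : ℂ | ∃ E, MeasurableSet E ∧ (gram u v E ^ k).trace = t}.Finite := by
  -- Zero is added by hand, because the two spectra are only compared away from zero.
  have hfin : (insert 0 (spectrum ℂ (gram u v (Set.univ : Set X)))).Finite := by
    refine Set.Finite.insert _ (Set.Finite.subset
      (gram u v (Set.univ : Set X)).charpoly.roots.toFinset.finite_toSet ?_)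
    intro c hc
    rw [Matrix.mem_spectrum_iff_isRoot_charpoly] at hc
    simpa [(Matrix.charpoly_monic _).ne_zero] using hc
  refine (finite_sums_of_finite (hfin.image (· ^ k)) n).subset ?_
  rintro t ⟨E, hE, rfl⟩
  refine ⟨(gram u v E ^ k).charpoly.roots, ?_, ?_, (Matrix.trace_eq_sum_roots_charpoly _).symm⟩
  · rw [IsAlgClosed.card_roots_eq_natDegree, Matrix.charpoly_natDegree_eq_dim, Fintype.card_fin]
  · intro x hx
    have hx' : x ∈ spectrum ℂ (gram u v E ^ k) :=
      Matrix.mem_spectrum_iff_isRoot_charpoly.2 (Polynomial.isRoot_of_mem_roots hx)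
    rw [spectrum.map_pow_of_pos _ hk] at hx'
    obtain ⟨c, hc, rfl⟩ := hx'
    refine ⟨c, ?_, rfl⟩
    by_cases hc0 : c = 0
    · exact Or.inl hc0
    · refine Or.inr ((mem_spectrum_compression_iff hrep MeasurableSet.univ hc0).1 ?_)
      exact spectrum_compression_subset_univ hinc hE
        ((mem_spectrum_compression_iff hrep hE hc0).2 hc)

theorem norm_setIntegral_sub_le {f : X → ℂ} (hf : Integrable f μ) {B : Set X}
    (hfin : μ B ≠ ∞) {c : ℂ} {ε : ℝ} (h : ∀ x ∈ B, ‖f x - c‖ ≤ ε) :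
    ‖∫ x in B, f x ∂μ - μ.real B * c‖ ≤ ε * μ.real B := by
  have h1 : ∫ x in B, (f x - c) ∂μ = ∫ x in B, f x ∂μ - μ.real B * c := by
    rw [integral_sub hf.integrableOn (integrableOn_const hfin), setIntegral_const]
    rfl
  rw [← h1]
  exact norm_setIntegral_le_of_norm_le_const hfin.lt_top h

theorem tendsto_average_gram {B : ℕ → Set X} (h0 : ∀ l, μ (B l) ≠ 0)
    (hfin : ∀ l, μ (B l) ≠ ∞) {p : KernelType n}
    (hp : ∀ U ∈ 𝓝 p, ∀ᶠ l in atTop, ∀ x ∈ B l, typeMap u v x ∈ U) :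
    Tendsto (fun l => (((μ.real (B l))⁻¹ : ℝ) : ℂ) • gram u v (B l)) atTop (𝓝 (typeMatrix p)) := by
  refine tendsto_pi_nhds.2 fun i => tendsto_pi_nhds.2 fun j => ?_
  rw [Metric.tendsto_atTop']
  intro ε hε
  have hU := (continuous_typeMatrix_apply i j).continuousAt.preimage_mem_nhds
    (Metric.closedBall_mem_nhds (typeMatrix p i j) (half_pos hε))
  obtain ⟨N, hN⟩ := eventually_atTop.1 (hp _ hU)
  refine ⟨N, fun l hl => ?_⟩
  have hpos : 0 < μ.real (B l) := ENNReal.toReal_pos (h0 l) (hfin l)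
  have hest := norm_setIntegral_sub_le (integrable_typeMatrix (u := u) (v := v) i j)
    (hfin l) (c := typeMatrix p i j) (ε := ε / 2) (fun x hx => by
      have := hN l hl.le x hx
      rw [Set.mem_preimage, mem_closedBall_iff_norm] at this
      exact this)
  rw [dist_eq_norm]
  change ‖(((μ.real (B l))⁻¹ : ℝ) : ℂ) * ∫ x in B l, typeMatrix (typeMap u v x) i j ∂μ
    - typeMatrix p i j‖ < ε
  have hne : ((μ.real (B l) : ℝ) : ℂ) ≠ 0 := by exact_mod_cast hpos.ne'
  have heq : (((μ.real (B l))⁻¹ : ℝ) : ℂ) * (∫ x in B l, typeMatrix (typeMap u v x) i j ∂μ)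
      - typeMatrix p i j = (((μ.real (B l))⁻¹ : ℝ) : ℂ) *
      ((∫ x in B l, typeMatrix (typeMap u v x) i j ∂μ) - μ.real (B l) * typeMatrix p i j) := by
    push_cast
    field_simp
  rw [heq, norm_mul, Complex.norm_real, Real.norm_of_nonneg (inv_nonneg.2 hpos.le)]
  calc (μ.real (B l))⁻¹ * _ ≤ (μ.real (B l))⁻¹ * (ε / 2 * μ.real (B l)) := by gcongr
    _ = ε / 2 := by field_simp
    _ < ε := half_lt_self hε

/-! ### Essential types, small types and loops -/

/-- The essential range of `typeMap u v` over the carrier `S`. -/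
def essTypes (S : Set X) (u v : Fin n → Lp ℂ 2 μ) : Set (KernelType n) :=
  ((μ.restrict S).map (typeMap u v)).support

theorem isClosed_essTypes (S : Set X) : IsClosed (essTypes S u v) := Measure.isClosed_support

theorem ae_typeMap_mem_essTypes (S : Set X) :
    ∀ᵐ x ∂μ.restrict S, typeMap u v x ∈ essTypes S u v :=
  ae_of_ae_map measurable_typeMap.aemeasurable Measure.support_mem_ae

theorem restrict_preimage_ne_zero {S : Set X} {p : KernelType n} (hp : p ∈ essTypes S u v)
    {U : Set (KernelType n)} (hU : U ∈ 𝓝 p) : μ.restrict S (typeMap u v ⁻¹' U) ≠ 0 := by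
  obtain ⟨V, hVU, hV, hpV⟩ := mem_nhds_iff.1 hU
  have := (Measure.mem_support_iff_forall _).1 hp V (hV.mem_nhds hpV)
  rw [Measure.map_apply measurable_typeMap hV.measurableSet] at this
  exact fun h => this.ne' (measure_mono_null (Set.preimage_mono hVU) h)

/-- Every neighbourhood of the type `p` is met on sets of arbitrarily small positive measure. -/
def IsSmallType (S : Set X) (u v : Fin n → Lp ℂ 2 μ) (p : KernelType n) : Prop :=
  ∀ U ∈ 𝓝 p, ∀ δ : ℝ≥0∞, 0 < δ →
    ∃ B ⊆ typeMap u v ⁻¹' U ∩ S, MeasurableSet B ∧ μ B ≠ 0 ∧ μ B < δ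

theorem exists_nhds_measure_lt_top {p : KernelType n} (hp : p.1 ≠ 0) :
    ∃ U ∈ 𝓝 p, μ (typeMap u v ⁻¹' U) < ∞ := by
  obtain ⟨i, hi⟩ := Function.ne_iff.1 hp
  have hpos : 0 < ‖p.1 i‖ := norm_pos_iff.2 hi
  refine ⟨{q | ‖p.1 i‖ / 2 < ‖q.1 i‖}, ?_, ?_⟩
  · refine (isOpen_lt continuous_const (by fun_prop)).mem_nhds ?_
    exact half_lt_self hpos
  · have h := (Lp.memLp (u i)).meas_ge_lt_top (by norm_num) (by norm_num)
      (ε := ⟨‖p.1 i‖ / 2, by positivity⟩) (by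
        intro h0; exact (half_pos hpos).ne' (congrArg NNReal.toReal h0))
    refine lt_of_le_of_lt (measure_mono ?_) h
    intro x hx
    exact le_of_lt (show ‖p.1 i‖ / 2 < ‖u i x‖ from hx)

/-- The preimages of balls shrinking to `p` keep measure at least `δ`, so continuity from above
gives the fibre positive measure. Finiteness, needed for that continuity, comes from `p.1 ≠ 0` and
Chebyshev's inequality. -/
theorem exists_le_measure_of_not_isSmallType {S : Set X} (hS : IsCarrier μ S)
    {p : KernelType n} (hp : p ∈ essTypes S u v) (hp0 : p.1 ≠ 0) (hsm : ¬ IsSmallType S u v p) :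
    μ.restrict S (typeMap u v ⁻¹' {p}) ≠ 0 ∧ μ.restrict S (typeMap u v ⁻¹' {p}) ≠ ∞ ∧
    ∃ δ > 0, ∀ B ⊆ typeMap u v ⁻¹' {p} ∩ S, MeasurableSet B → μ B ≠ 0 → δ ≤ μ B := by
  unfold IsSmallType at hsm
  push Not at hsm
  obtain ⟨U₁, hU₁, δ, hδ, hsm⟩ := hsm
  obtain ⟨U₂, hU₂, hfin⟩ := exists_nhds_measure_lt_top (u := u) (v := v) hp0
  obtain ⟨r, hr, hrU⟩ := Metric.mem_nhds_iff.1 (inter_mem hU₁ hU₂)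
  have hp1 : typeMap u v ⁻¹' {p} ⊆ typeMap u v ⁻¹' U₁ := Set.preimage_mono
    (Set.singleton_subset_iff.2 (mem_of_mem_nhds hU₁))
  have hp2 : typeMap u v ⁻¹' {p} ⊆ typeMap u v ⁻¹' U₂ := Set.preimage_mono
    (Set.singleton_subset_iff.2 (mem_of_mem_nhds hU₂))
  have hmeas : ∀ U : Set (KernelType n), MeasurableSet U →
      MeasurableSet (typeMap u v ⁻¹' U) := fun U hU => measurable_typeMap hU
  refine ⟨?_, ?_, δ, hδ, ?_⟩
  · let A : ℕ → Set X := fun k => typeMap u v ⁻¹' Metric.ball p (r / (k + 1))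
    have hAr : ∀ k : ℕ, Metric.ball p (r / (k + 1)) ⊆ Metric.ball p r := fun k =>
      Metric.ball_subset_ball (div_le_self hr.le (by
        have : (0 : ℝ) ≤ k := Nat.cast_nonneg k
        linarith))
    have hA : Antitone A := by
      intro k l hkl
      refine Set.preimage_mono (Metric.ball_subset_ball ?_)
      have : (k : ℝ) ≤ l := by exact_mod_cast hkl
      gcongr
    have hinter : typeMap u v ⁻¹' {p} = ⋂ k, A k := by
      rw [← Set.preimage_iInter]
      congr 1
      ext q
      simp only [Set.mem_singleton_iff, Set.mem_iInter, Metric.mem_ball]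
      constructor
      · rintro rfl k
        rw [dist_self]
        positivity
      · intro h
        by_contra hne
        obtain ⟨k, hk⟩ := exists_nat_one_div_lt (div_pos (dist_pos.2 hne) hr)
        have := h k
        rw [lt_div_iff₀ hr] at hk
        rw [one_div, inv_mul_eq_div] at hk
        linarith
    have hAle : ∀ k, δ ≤ μ.restrict S (A k) := by
      intro k
      rw [Measure.restrict_apply (hmeas _ measurableSet_ball)]
      refine hsm (A k ∩ S) ?_ ((hmeas _ measurableSet_ball).inter hS.measurableSet) ?_
      · exact Set.inter_subset_inter_left _
          (Set.preimage_mono (((hAr k).trans hrU).trans Set.inter_subset_left))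
      · rw [← Measure.restrict_apply (hmeas _ measurableSet_ball)]
        exact restrict_preimage_ne_zero hp (Metric.ball_mem_nhds p (by positivity))
    have hlim := tendsto_measure_iInter_atTop (μ := μ.restrict S)
      (fun k : ℕ => (hmeas _ (measurableSet_ball (x := p) (ε := r / (k + 1)))).nullMeasurableSet) hA
      ⟨0, ne_top_of_le_ne_top hfin.ne ((Measure.restrict_apply_le _ _).trans
        (measure_mono (Set.preimage_mono (((hAr 0).trans hrU).trans Set.inter_subset_right))))⟩
    rw [hinter]
    exact (lt_of_lt_of_le hδ (ge_of_tendsto' hlim hAle)).ne'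
  · exact ne_top_of_le_ne_top hfin.ne ((Measure.restrict_apply_le _ _).trans (measure_mono hp2))
  · intro B hB hBm hB0
    exact hsm B (hB.trans (Set.inter_subset_inter_left _ hp1)) hBm hB0

/-- Choose `a` with measure within `δ` of the infimum over non-null subsets. Splitting it into two
non-null pieces would give total measure at least the infimum plus `δ`. -/
theorem exists_isAtomOf_subset {ν : Measure X} {A : Set X} (hA : MeasurableSet A) (h0 : ν A ≠ 0)
    (hfin : ν A ≠ ∞) {δ : ℝ≥0∞} (hδ : 0 < δ)
    (hle : ∀ B ⊆ A, MeasurableSet B → ν B ≠ 0 → δ ≤ ν B) :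
    ∃ a ⊆ A, IsAtomOf ν a := by
  let I := ⨅ B : {B : Set X // B ⊆ A ∧ MeasurableSet B ∧ ν B ≠ 0}, ν B
  have hI : I ≠ ∞ := ne_top_of_le_ne_top hfin
    (iInf_le (fun B : {B : Set X // B ⊆ A ∧ MeasurableSet B ∧ ν B ≠ 0} => ν B)
      ⟨A, subset_rfl, hA, h0⟩)
  have hlt : I < I + δ := ENNReal.lt_add_right hI hδ.ne'
  obtain ⟨⟨a, haA, ha, ha0⟩, hlt⟩ := iInf_lt_iff.1 hlt
  refine ⟨a, haA, ha, ha0, fun B hBa hB => ?_⟩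
  by_contra! hne
  have h1 : I ≤ ν B := iInf_le (fun B : {B : Set X // B ⊆ A ∧ MeasurableSet B ∧ ν B ≠ 0} => ν B)
    ⟨B, hBa.trans haA, hB, hne.1⟩
  have h2 : δ ≤ ν (a \ B) := hle _ (Set.sdiff_subset.trans haA) (ha.diff hB) hne.2
  have h3 : ν B + ν (a \ B) = ν a := by
    rw [← measure_union Set.disjoint_sdiff_right (ha.diff hB), Set.union_sdiff_cancel hBa]
  exact absurd (h3 ▸ add_le_add h1 h2) (not_le.2 hlt)

theorem exists_pos_forall_le_norm {F : Set ℂ} (hF : F.Finite) :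
    ∃ η > 0, ∀ t ∈ F, t ≠ 0 → η ≤ ‖t‖ := by
  have hcl : IsClosed (F \ {0}) := (hF.subset Set.sdiff_subset).isClosed
  obtain ⟨η, hη, hball⟩ := Metric.isOpen_iff.1 hcl.isOpen_compl 0 (by simp)
  refine ⟨η, hη, fun t ht h0 => ?_⟩
  by_contra! hlt
  exact hball (by simpa using hlt) ⟨ht, h0⟩

theorem trace_gram (E : Set X) :
    (gram u v E).trace = ∫ x in E, kern (typeMap u v x) (typeMap u v x) ∂μ := by
  simp_rw [← trace_typeMatrix]
  unfold Matrix.trace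
  rw [integral_finsetSum]
  · rfl
  · exact fun i _ => (integrable_typeMatrix i i).integrableOn

theorem integrable_kern_diag :
    Integrable (fun x => kern (typeMap u v x) (typeMap u v x)) μ := by
  simp_rw [← trace_typeMatrix]
  unfold Matrix.trace
  exact integrable_finsetSum _ fun i _ => integrable_typeMatrix i i

/-- On a small set `B` near `p` the trace of the Gram matrix is close to `μ(B) · kern p p`: non-zero
yet arbitrarily small, whereas finitely many values leave a gap around zero. -/
theorem not_isSmallType_of_loop {S : Set X} (hrep : ∀ h, K h = ∑ i, inner ℂ (v i) h • u i)
    (hinc : HasIncreasingSpectrum K) {p : KernelType n} (hpp : kern p p ≠ 0) :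
    ¬ IsSmallType S u v p := by
  intro hsm
  obtain ⟨η, hη, hηle⟩ := exists_pos_forall_le_norm (finite_trace_gram_pow hrep hinc one_pos)
  have hc : 0 < ‖kern p p‖ := norm_pos_iff.2 hpp
  have hcont : Continuous fun q : KernelType n => kern q q :=
    continuous_kern.comp (continuous_id.prodMk continuous_id)
  have hU := hcont.continuousAt.preimage_mem_nhds
    (Metric.closedBall_mem_nhds (kern p p) (half_pos hc))
  -- With integrand within `‖kern p p‖ / 2` of `kern p p`, the trace is at most `3/2 · ‖kern p p‖ ·
  -- μ(B)`, which this bound on `μ(B)` keeps below `3η/4`.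
  obtain ⟨B, hBU, hB, hB0, hBlt⟩ := hsm _ hU (ENNReal.ofReal (η / (2 * ‖kern p p‖)))
    (ENNReal.ofReal_pos.2 (by positivity))
  have hfin : μ B ≠ ∞ := (hBlt.trans ENNReal.ofReal_lt_top).ne
  have hpos : 0 < μ.real B := ENNReal.toReal_pos hB0 hfin
  have hlt : μ.real B < η / (2 * ‖kern p p‖) :=
    (ENNReal.lt_ofReal_iff_toReal_lt hfin).1 hBlt
  have hest := norm_setIntegral_sub_le (integrable_kern_diag (u := u) (v := v))
    hfin (c := kern p p) (ε := ‖kern p p‖ / 2) (fun x hx => by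
      have := (hBU hx).1
      rw [Set.mem_preimage, Set.mem_preimage, mem_closedBall_iff_norm] at this
      exact this)
  rw [← trace_gram] at hest
  have hnorm : ‖((μ.real B : ℝ) : ℂ) * kern p p‖ = μ.real B * ‖kern p p‖ := by
    rw [norm_mul, Complex.norm_real, Real.norm_of_nonneg hpos.le]
  have hne : (gram u v B).trace ≠ 0 := by
    intro h0
    rw [h0, zero_sub, norm_neg, hnorm] at hest
    nlinarith
  have hle := hηle _ ⟨B, hB, by rw [pow_one]⟩ hne
  have htri : ‖(gram u v B).trace‖ ≤ 3 / 2 * ‖kern p p‖ * μ.real B := by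
    have := norm_le_norm_add_norm_sub (((μ.real B : ℝ) : ℂ) * kern p p) (gram u v B).trace
    rw [hnorm, norm_sub_rev] at this
    linarith
  rw [lt_div_iff₀ (by positivity)] at hlt
  nlinarith

theorem gram_eq_of_subset_preimage {p : KernelType n} {B : Set X} (hB : MeasurableSet B)
    (hBp : B ⊆ typeMap u v ⁻¹' {p}) : gram u v B = ((μ.real B : ℝ) : ℂ) • typeMatrix p := by
  ext i j
  have : ∫ x in B, typeMatrix (typeMap u v x) i j ∂μ = ∫ _ in B, typeMatrix p i j ∂μ :=
    setIntegral_congr_fun hB fun x hx => by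
      rw [show typeMap u v x = p from hBp hx]
  rw [setIntegral_const] at this
  exact this

theorem mem_spectrum_smul_typeMatrix {p : KernelType n} {a c : ℂ} (hc : c ≠ 0) :
    c ∈ spectrum ℂ (a • typeMatrix p) ↔ c = a * kern p p := by
  have hmul : ∀ z, (a • typeMatrix p) *ᵥ z = (a * (p.1 ⬝ᵥ z)) • p.2 := by
    intro z
    rw [Matrix.smul_mulVec, typeMatrix, Matrix.vecMulVec_mulVec]
    ext i
    simp [mul_assoc]
  rw [matrix_mem_spectrum_iff]
  constructor
  · rintro ⟨z, hz, h⟩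
    rw [hmul] at h
    have h1 : p.1 ⬝ᵥ z ≠ 0 := by
      intro h0
      rw [h0, mul_zero, zero_smul] at h
      exact (smul_ne_zero hc hz) h.symm
    have h2 := congrArg (fun w => p.1 ⬝ᵥ w) h
    simp only [dotProduct_smul, smul_eq_mul] at h2
    refine mul_right_cancel₀ h1 ?_
    rw [← h2, kern]
    ring
  · rintro rfl
    refine ⟨p.2, ?_, hmul _⟩
    intro h0
    apply hc
    rw [kern, h0, dotProduct_zero, mul_zero]

/-- On a subset `B` of the fibre the only non-zero eigenvalue is `μ(B) · kern p p`. Since it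
persists on the whole fibre, a non-null `B` must have the full measure of the fibre. -/
theorem isAtomOf_preimage_of_loop {S : Set X} (hS : IsCarrier μ S)
    (hrep : ∀ h, K h = ∑ i, inner ℂ (v i) h • u i)
    (hinc : HasIncreasingSpectrum K) {p : KernelType n} (hp : p ∈ essTypes S u v)
    (hpp : kern p p ≠ 0) : IsAtomOf (μ.restrict S) (typeMap u v ⁻¹' {p}) := by
  have hp0 : p.1 ≠ 0 := by
    intro h0
    rw [kern, h0, zero_dotProduct] at hpp
    exact hpp rfl
  obtain ⟨hne, hfin, -⟩ := exists_le_measure_of_not_isSmallType hS hp hp0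
    (not_isSmallType_of_loop hrep hinc hpp)
  have hm : MeasurableSet (typeMap u v ⁻¹' {p}) := measurable_typeMap (measurableSet_singleton p)
  refine ⟨hm, hne, fun B hB hBm => ?_⟩
  by_contra! hcon
  rw [Measure.restrict_apply hm] at hfin
  rw [Measure.restrict_apply hBm, Measure.restrict_apply (hm.diff hBm)] at hcon
  set A := typeMap u v ⁻¹' {p} ∩ S with hA
  have hBA : B ∩ S ⊆ A := Set.inter_subset_inter_left _ hB
  have hBS := hBm.inter hS.measurableSet
  have hAm := hm.inter hS.measurableSet
  have hBfin : μ (B ∩ S) ≠ ∞ := ne_top_of_le_ne_top hfin (measure_mono hBA)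
  have hBpos : 0 < μ.real (B ∩ S) := ENNReal.toReal_pos hcon.1 hBfin
  have hc0 : ((μ.real (B ∩ S) : ℝ) : ℂ) * kern p p ≠ 0 :=
    mul_ne_zero (by exact_mod_cast hBpos.ne') hpp
  have h1 : ((μ.real (B ∩ S) : ℝ) : ℂ) * kern p p ∈ spectrum ℂ (compression K hBS) := by
    rw [mem_spectrum_compression_iff hrep hBS hc0,
      gram_eq_of_subset_preimage hBS (hBA.trans Set.inter_subset_left),
      mem_spectrum_smul_typeMatrix hc0]
  have hsub : standardSubspace μ (B ∩ S) ≤ standardSubspace μ A := fun f hf => by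
    filter_upwards [mem_standardSubspace.1 hf] with x hx hxA
    exact hx fun hxB => hxA (hBA hxB)
  have h2 := hinc _ _ hBS hAm hsub h1
  rw [mem_spectrum_compression_iff hrep hAm hc0,
    gram_eq_of_subset_preimage hAm Set.inter_subset_left, mem_spectrum_smul_typeMatrix hc0] at h2
  have h3 : μ.real (B ∩ S) = μ.real A := by exact_mod_cast mul_right_cancel₀ hpp h2
  have h4 : A \ (B ∩ S) = typeMap u v ⁻¹' {p} \ B ∩ S := by
    ext x
    simp only [hA, Set.mem_sdiff, Set.mem_inter_iff]
    tauto
  have h5 := measureReal_sdiff hBA hBS hfin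
  rw [h3, sub_self, h4] at h5
  exact hcon.2 ((measureReal_eq_zero_iff (ne_top_of_le_ne_top hfin (measure_mono
    (Set.inter_subset_inter_left _ Set.sdiff_subset)))).1 h5)

/-! ### Polarization and traces of products -/

theorem alternating_sum_eq_zero {ι : Type*} [Fintype ι] [DecidableEq ι] (F : Finset ι → ℂ) (j : ι)
    (h : ∀ s, j ∉ s → F (insert j s) = F s) : ∑ s : Finset ι, (-1 : ℂ) ^ s.card * F s = 0 := by
  rw [← Finset.powerset_univ, ← Finset.insert_erase (Finset.mem_univ j),
    Finset.sum_powerset_insert (Finset.notMem_erase j _), ← Finset.sum_add_distrib]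
  refine Finset.sum_eq_zero fun s hs => ?_
  have hj : j ∉ s := fun hj => Finset.notMem_erase j _ (Finset.mem_powerset.1 hs hj)
  rw [h s hj, Finset.card_insert_of_notMem hj, pow_succ]
  ring

/-- The symmetrization of a multilinear map. -/
def symmetrization {ι A : Type*} [Fintype ι] [DecidableEq ι] [AddCommGroup A] [Module ℂ A]
    (f : MultilinearMap ℂ (fun _ : ι => A) ℂ) : MultilinearMap ℂ (fun _ : ι => A) ℂ :=
  ∑ σ : Equiv.Perm ι, f.domDomCongr σ

theorem symmetrization_apply {ι A : Type*} [Fintype ι] [DecidableEq ι] [AddCommGroup A]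
    [Module ℂ A] (f : MultilinearMap ℂ (fun _ : ι => A) ℂ) (x : ι → A) :
    symmetrization f x = ∑ σ : Equiv.Perm ι, f fun i => x (σ i) := by
  simp [symmetrization]

/-- The polarization identity: the symmetrization is, up to sign, the alternating sum over subsets
`s` of the values of `f` on the diagonal at `∑ i ∈ s, x i`. If the index `j` has no effect, the
terms cancel in pairs. -/
theorem symmetrization_eq_zero {ι A : Type*} [Fintype ι] [DecidableEq ι] [AddCommGroup A]
    [Module ℂ A] (f : MultilinearMap ℂ (fun _ : ι => A) ℂ) (x : ι → A) (j : ι)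
    (h : ∀ s : Finset ι, j ∉ s →
      f (fun _ => ∑ i ∈ insert j s, x i) = f (fun _ => ∑ i ∈ s, x i)) :
    symmetrization f x = 0 := by
  have h0 := alternating_sum_eq_zero (fun s => f fun _ => ∑ i ∈ s, x i) j h
  have hexp : ∀ s : Finset ι, f (fun _ => ∑ i ∈ s, x i) =
      ∑ r : ι → ι, if Finset.univ.image r ⊆ s then f (fun i => x (r i)) else 0 := by
    intro s
    rw [f.map_sum_finset (fun _ i => x i) (fun _ => s), ← Finset.sum_filter]
    refine Finset.sum_congr ?_ fun _ _ => rfl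
    ext r
    simp [Fintype.mem_piFinset, Finset.image_subset_iff]
  simp_rw [hexp, Finset.mul_sum] at h0
  rw [Finset.sum_comm] at h0
  -- A multi-index `r` missing some `b` contributes equally to `s` and `insert b s`, so it cancels;
  -- only permutations remain, each seen by the full set alone.
  have hinner : ∀ r : ι → ι, (∑ s : Finset ι, (-1 : ℂ) ^ s.card *
      (if Finset.univ.image r ⊆ s then f (fun i => x (r i)) else 0)) =
      if Function.Bijective r then (-1 : ℂ) ^ Fintype.card ι * f (fun i => x (r i)) else 0 := by
    intro r
    by_cases hr : Function.Bijective r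
    · rw [if_pos hr, Finset.sum_eq_single Finset.univ]
      · simp [Finset.card_univ]
      · intro s _ hs
        rw [if_neg, mul_zero]
        intro hsub
        apply hs
        rw [Finset.image_univ_of_surjective hr.2] at hsub
        exact Finset.univ_subset_iff.1 hsub
      · simp
    · rw [if_neg hr]
      have hsurj : ¬ Function.Surjective r := fun hs => hr (Finite.surjective_iff_bijective.1 hs)
      unfold Function.Surjective at hsurj
      push Not at hsurj
      obtain ⟨b, hb⟩ := hsurj
      refine alternating_sum_eq_zero _ b fun s _ => ?_
      have hiff : Finset.univ.image r ⊆ insert b s ↔ Finset.univ.image r ⊆ s := by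
        rw [Finset.subset_insert_iff_of_notMem]
        simpa using hb
      simp only [hiff]
  simp_rw [hinner, ← Finset.sum_filter, ← Finset.mul_sum] at h0
  have h1 := (mul_eq_zero.1 h0).resolve_left (pow_ne_zero _ (by norm_num))
  rw [symmetrization_apply, ← h1]
  refine Finset.sum_bij (fun σ _ => ⇑σ) ?_ ?_ ?_ ?_
  · intro σ _
    simp
  · intro σ _ τ _ hστ
    exact DFunLike.coe_injective hστ
  · intro r hr
    exact ⟨Equiv.ofBijective r (Finset.mem_filter.1 hr).2, Finset.mem_univ _, rfl⟩
  · intro σ _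
    rfl

/-- The trace of a product of `m` matrices, as a multilinear map. -/
def traceProd (n m : ℕ) : MultilinearMap ℂ (fun _ : Fin m => Matrix (Fin n) (Fin n) ℂ) ℂ :=
  (Matrix.traceLinearMap (Fin n) ℂ ℂ).compMultilinearMap
    (MultilinearMap.mkPiAlgebraFin ℂ m (Matrix (Fin n) (Fin n) ℂ))

theorem traceProd_apply {n m : ℕ} (x : Fin m → Matrix (Fin n) (Fin n) ℂ) :
    traceProd n m x = (List.ofFn x).prod.trace := rfl

theorem traceProd_const {n m : ℕ} (A : Matrix (Fin n) (Fin n) ℂ) :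
    traceProd n m (fun _ => A) = (A ^ m).trace := by
  rw [traceProd_apply, List.ofFn_const, List.prod_replicate]

theorem continuous_symmetrization_traceProd (n m : ℕ) :
    Continuous (symmetrization (traceProd n m)) := by
  have : ⇑(symmetrization (traceProd n m)) =
      fun x => ∑ σ : Equiv.Perm (Fin m), traceProd n m fun i => x (σ i) :=
    funext fun x => symmetrization_apply _ x
  rw [this]
  refine continuous_finsetSum _ fun σ _ => ?_
  have h1 := (ContinuousMultilinearMap.mkPiAlgebraFin ℂ m (Matrix (Fin n) (Fin n) ℂ)).cont
  exact (h1.comp (continuous_pi fun i => continuous_apply (σ i))).matrix_trace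

theorem prod_ofFn_typeMatrix {m : ℕ} (q : Fin (m + 1) → KernelType n) :
    (List.ofFn fun i => typeMatrix (q i)).prod =
      (∏ i : Fin m, kern (q i.castSucc) (q i.succ)) •
        Matrix.vecMulVec (q 0).2 (q (Fin.last m)).1 := by
  induction m with
  | zero => simp [typeMatrix]
  | succ m ih =>
    rw [List.ofFn_succ, List.prod_cons, ih fun i => q i.succ, Fin.prod_univ_succ, mul_smul_comm,
      typeMatrix, Matrix.vecMulVec_mul_vecMulVec, Fin.castSucc_zero, Fin.succ_last]
    simp only [Fin.succ_castSucc]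
    ext i j
    simp [Matrix.vecMulVec, kern]
    ring

theorem traceProd_typeMatrix {m : ℕ} (q : Fin (m + 1) → KernelType n) :
    traceProd n (m + 1) (fun i => typeMatrix (q i)) = ∏ i, kern (q i) (q (i + 1)) := by
  rw [traceProd_apply, prod_ofFn_typeMatrix, Matrix.trace_smul, Matrix.trace_vecMulVec,
    Fin.prod_univ_castSucc, Fin.last_add_one, smul_eq_mul, dotProduct_comm]
  simp only [Fin.coeSucc_eq_succ]
  rfl

/-! ### Shortest cycles -/

/-- A walk of the relation `r` of period `m`. -/
def HasPeriodicWalk {V : Type*} (r : V → V → Prop) (m : ℕ) : Prop :=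
  0 < m ∧ ∃ w : ℕ → V, (∀ i, w (i + m) = w i) ∧ ∀ i, r (w i) (w (i + 1))

theorem hasPeriodicWalk_of_segment {V : Type*} {r : V → V → Prop} (w : ℕ → V) (j L : ℕ)
    (hw : ∀ t < L, r (w (j + t)) (w (j + t + 1))) (hback : r (w (j + L)) (w j)) :
    HasPeriodicWalk r (L + 1) := by
  refine ⟨L.succ_pos, fun t => w (j + t % (L + 1)), fun i => by simp, fun i => ?_⟩
  by_cases h : i % (L + 1) = L
  · have : (i + 1) % (L + 1) = 0 := by
      rw [Nat.add_mod, h]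
      rcases L with _ | L <;> simp
    simp only [h, this]
    exact hback
  · have hlt : i % (L + 1) < L := lt_of_le_of_ne (Nat.lt_succ_iff.1 (Nat.mod_lt _ L.succ_pos)) h
    have : (i + 1) % (L + 1) = i % (L + 1) + 1 := by
      rw [Nat.add_mod, Nat.mod_eq_of_lt (a := 1) (by omega), Nat.mod_eq_of_lt (by omega)]
    simp only [this]
    exact hw _ hlt

/-- A chord from `w i` to `w j` closes the segment from `w j` to `w (i + m) = w i` into a cycle of
length `i + m - j + 1`, shorter than `m` unless `j = i + 1`. -/
theorem eq_succ_of_minimal_walk {V : Type*} {r : V → V → Prop} {m : ℕ} {w : ℕ → V}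
    (hper : ∀ i, w (i + m) = w i) (hw : ∀ i, r (w i) (w (i + 1)))
    (hmin : ∀ k < m, ¬ HasPeriodicWalk r k) {i j : ℕ} (hij : i < j) (hjm : j ≤ i + m)
    (h : r (w i) (w j)) : j = i + 1 := by
  by_contra hne
  obtain ⟨L, hL⟩ := Nat.exists_eq_add_of_le hjm
  refine hmin (L + 1) (by omega) (hasPeriodicWalk_of_segment w j L (fun t _ => hw _) ?_)
  rw [← hL, hper]
  exact h

theorem injOn_of_minimal_walk {V : Type*} {r : V → V → Prop} {m : ℕ} {w : ℕ → V}
    (hper : ∀ i, w (i + m) = w i) (hw : ∀ i, r (w i) (w (i + 1)))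
    (hmin : ∀ k < m, ¬ HasPeriodicWalk r k) {i j : ℕ} (hi : i < m) (hj : j < m)
    (h : w i = w j) : i = j := by
  have key : ∀ i j, i < j → j < m → w i ≠ w j := by
    intro i j hij hj h
    have h1 : r (w j) (w (i + 1 + m)) := by
      rw [hper, ← h]
      exact hw i
    have := eq_succ_of_minimal_walk hper hw hmin (by omega) (by omega) h1
    omega
  rcases lt_trichotomy i j with hij | hij | hij
  · exact absurd h (key i j hij hj)
  · exact hij
  · exact absurd h.symm (key j i hij hi)

/-- Two distinct kernel types with a non-zero pairing. -/
def Edge (R : Set (KernelType n)) (p q : R) : Prop :=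
  p ≠ q ∧ kern (p : KernelType n) q ≠ 0

theorem kern_eq_zero_of_minimal_walk {R : Set (KernelType n)} {m : ℕ} {w : ℕ → R}
    (hper : ∀ i, w (i + m) = w i) (hw : ∀ i, Edge R (w i) (w (i + 1)))
    (hmin : ∀ k < m, ¬ HasPeriodicWalk (Edge R) k) {i j : ℕ} (hi : i < m) (hj : j < m)
    (hij : i ≠ j) (hne : w j ≠ w (i + 1)) : kern (w i : KernelType n) (w j) = 0 := by
  by_contra hk
  have hE : Edge R (w i) (w j) :=
    ⟨fun h => hij (injOn_of_minimal_walk hper hw hmin hi hj h), hk⟩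
  rcases lt_or_gt_of_ne hij with h | h
  · exact hne (by rw [eq_succ_of_minimal_walk hper hw hmin h (by omega) hE])
  · rw [← hper j] at hE
    have := eq_succ_of_minimal_walk hper hw hmin (by omega) (by omega) hE
    exact hne (by rw [← hper j, this])

theorem periodic_fin_add_one {V : Type*} {m : ℕ} {w : ℕ → V} (hper : ∀ i, w (i + (m + 1)) = w i)
    (i : Fin (m + 1)) : w ((i + 1 : Fin (m + 1)) : ℕ) = w (i + 1) := by
  rcases Fin.eq_castSucc_or_eq_last i with ⟨j, rfl⟩ | rfl
  · rw [Fin.coeSucc_eq_succ]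
    rfl
  · rw [Fin.last_add_one]
    exact (hper 0).symm.trans (by simp)

theorem fin_add_one_ne {m : ℕ} (hm : 0 < m) (i : Fin (m + 1)) : i ≠ i + 1 := by
  intro h
  have h' : (1 : Fin (m + 1)) = 0 := by simpa using h.symm
  exact hm.ne' (Nat.succ_injective (Fin.one_eq_zero_iff.1 h'))

theorem pos_of_walk {R : Set (KernelType n)} {m : ℕ} {w : ℕ → R}
    (hper : ∀ i, w (i + (m + 1)) = w i) (hw : ∀ i, Edge R (w i) (w (i + 1))) : 0 < m := by
  rcases Nat.eq_zero_or_pos m with rfl | h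
  · exact absurd (hper 0).symm (hw 0).1
  · exact h

/-- The term of a permutation `σ` is the product of the pairings along the reordered cycle. Without
chords it is non-zero only if each `σ (i + 1)` follows `σ i` on the cycle, and then it equals the
product of all edge weights. The surviving terms are thus equal, and the identity is one of them. -/
theorem symmetrization_traceProd_ne_zero {R : Set (KernelType n)} {m : ℕ} {w : ℕ → R}
    (hper : ∀ i, w (i + (m + 1)) = w i) (hw : ∀ i, Edge R (w i) (w (i + 1)))
    (hmin : ∀ k < m + 1, ¬ HasPeriodicWalk (Edge R) k) :
    symmetrization (traceProd n (m + 1))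
      (fun i : Fin (m + 1) => typeMatrix (w i : KernelType n)) ≠ 0 := by
  have hm : 0 < m := pos_of_walk hper hw
  have hsucc := periodic_fin_add_one hper
  set P : ℂ := ∏ i : Fin (m + 1), kern (w i : KernelType n) (w (i + 1)) with hP
  have hP0 : P ≠ 0 := Finset.prod_ne_zero_iff.2 fun i _ => (hw i).2
  let T : Equiv.Perm (Fin (m + 1)) → ℂ := fun σ =>
    ∏ i, kern (w (σ i : ℕ) : KernelType n) (w (σ (i + 1) : ℕ))
  have hT : ∀ σ, T σ ≠ 0 → T σ = P := by
    intro σ hσ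
    have hfac := Finset.prod_ne_zero_iff.1 hσ
    rw [hP, ← Equiv.prod_comp σ]
    refine Finset.prod_congr rfl fun i hi => ?_
    by_contra hne
    have hne' : w (σ (i + 1) : ℕ) ≠ w ((σ i : ℕ) + 1) := fun h => hne (by rw [h])
    refine hfac i hi (kern_eq_zero_of_minimal_walk hper hw hmin (σ i).2 (σ (i + 1)).2 ?_ hne')
    intro h
    exact fin_add_one_ne hm i (σ.injective (Fin.ext h))
  have hT1 : T 1 = P := Finset.prod_congr rfl fun i _ => by
    simp only [Equiv.Perm.coe_one, id_eq, hsucc]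
  have hsum : symmetrization (traceProd n (m + 1))
      (fun i : Fin (m + 1) => typeMatrix (w i : KernelType n)) = ∑ σ, T σ := by
    rw [symmetrization_apply]
    exact Finset.sum_congr rfl fun σ _ =>
      traceProd_typeMatrix fun i => (w (σ i : ℕ) : KernelType n)
  rw [hsum]
  have hsum' : ∑ σ, T σ = ∑ σ ∈ Finset.univ.filter (fun σ => T σ ≠ 0), P := by
    rw [Finset.sum_filter]
    refine Finset.sum_congr rfl fun σ _ => ?_
    by_cases h : T σ = 0
    · rw [if_neg (not_not.2 h), h]
    · rw [if_pos h, hT σ h]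
  rw [hsum', Finset.sum_const, nsmul_eq_mul]
  refine mul_ne_zero (Nat.cast_ne_zero.2 (Finset.card_ne_zero.2 ⟨1, ?_⟩)) hP0
  simpa [hT1] using hP0

theorem eventually_eq_of_tendsto_of_finite {F : Set ℂ} (hF : F.Finite) {a : ℕ → ℂ} {b : ℂ}
    (ha : ∀ s, a s ∈ F) (h : Tendsto a atTop (𝓝 b)) : ∀ᶠ s in atTop, a s = b := by
  have hcl : IsClosed (F \ {b}) := (hF.subset Set.sdiff_subset).isClosed
  filter_upwards [h.eventually (hcl.isOpen_compl.mem_nhds (show b ∈ (F \ {b})ᶜ by simp))]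
    with s hs
  by_contra hne
  exact hs ⟨ha s, hne⟩

theorem eventually_ball_subset_of_nhds {p : KernelType n} {U : Set (KernelType n)} (hU : U ∈ 𝓝 p) :
    ∀ᶠ l : ℕ in atTop, Metric.ball p (1 / ((l : ℝ) + 1)) ⊆ U := by
  obtain ⟨r, hr, hrU⟩ := Metric.mem_nhds_iff.1 hU
  filter_upwards [(tendsto_order.1 (tendsto_one_div_add_atTop_nhds_zero_nat (𝕜 := ℝ))).2 r hr]
    with l hl
  exact (Metric.ball_subset_ball hl.le).trans hrU

/-! ### Excluding cycles -/

/-- Gram matrices of sets concentrating at the types `p i`, divided by their measures, tend to the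
rank one matrices. The set near `p i₀` is shrunk first, the others held fixed: its Gram matrix tends
to zero, so traces of powers with and without it converge to each other and, being finitely valued,
eventually agree. Polarization then gives zero before any limit in the other sets is taken. -/
theorem symmetrization_traceProd_eq_zero_of_isSmallType {S : Set X} (hS : IsCarrier μ S)
    (hrep : ∀ h, K h = ∑ i, inner ℂ (v i) h • u i) (hinc : HasIncreasingSpectrum K)
    {m : ℕ} (hm : 0 < m) {p : Fin m → KernelType n} (hp : ∀ i, p i ∈ essTypes S u v)
    (hinj : Function.Injective p) (i₀ : Fin m) (hsm : IsSmallType S u v (p i₀)) :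
    symmetrization (traceProd n m) (fun i => typeMatrix (p i)) = 0 := by
  -- Disjoint neighbourhoods of the types make the chosen sets disjoint, so that the Gram matrix of
  -- a union is the sum.
  obtain ⟨U, hU, hdisj⟩ := (Set.finite_range p).t2_separation
  have hdisjU : ∀ i j, i ≠ j → Disjoint (U (p i)) (U (p j)) := fun i j hij =>
    hdisj (Set.mem_range_self i) (Set.mem_range_self j) (hinj.ne hij)
  have hnhds : ∀ i (l : ℕ), U (p i) ∩ Metric.ball (p i) (1 / ((l : ℝ) + 1)) ∈ 𝓝 (p i) :=
    fun i l => inter_mem ((hU (p i)).2.mem_nhds (hU (p i)).1) (Metric.ball_mem_nhds _ (by positivity))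
  have hC : ∀ i (l : ℕ), ∃ B ⊆ typeMap u v ⁻¹' (U (p i) ∩ Metric.ball (p i) (1 / ((l : ℝ) + 1))),
      MeasurableSet B ∧ μ B ≠ 0 ∧ μ B ≠ ∞ := by
    intro i l
    obtain ⟨B, hB, hBm, h0, h1⟩ := hS.exists_finite_subset
      (measurable_typeMap ((hU (p i)).2.measurableSet.inter measurableSet_ball))
      (restrict_preimage_ne_zero (hp i) (hnhds i l))
    exact ⟨B, hB.trans Set.inter_subset_left, hBm, h0, h1⟩
  choose C hCsub hCm hC0 hC1 using hC
  have hD : ∀ l : ℕ, ∃ B ⊆ typeMap u v ⁻¹' (U (p i₀) ∩ Metric.ball (p i₀) (1 / ((l : ℝ) + 1))),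
      MeasurableSet B ∧ μ B ≠ 0 ∧ μ B < ENNReal.ofReal (1 / ((l : ℝ) + 1)) := by
    intro l
    obtain ⟨B, hB, hBm, h0, h1⟩ := hsm _ (hnhds i₀ l) (ENNReal.ofReal (1 / ((l : ℝ) + 1)))
      (ENNReal.ofReal_pos.2 (by positivity))
    exact ⟨B, hB.trans Set.inter_subset_left, hBm, h0, h1⟩
  choose D hDsub hDm hD0 hD1 using hD
  have hDfin : ∀ l, μ (D l) ≠ ∞ := fun l => ((hD1 l).trans ENNReal.ofReal_lt_top).ne
  have hDavg : Tendsto (fun l => (((μ.real (D l))⁻¹ : ℝ) : ℂ) • gram u v (D l)) atTop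
      (𝓝 (typeMatrix (p i₀))) := by
    refine tendsto_average_gram hD0 hDfin fun W hW => ?_
    filter_upwards [eventually_ball_subset_of_nhds hW] with l hl x hx
    exact hl (hDsub l hx).2
  have hCavg : ∀ i, Tendsto (fun l => (((μ.real (C i l))⁻¹ : ℝ) : ℂ) • gram u v (C i l)) atTop
      (𝓝 (typeMatrix (p i))) := by
    intro i
    refine tendsto_average_gram (hC0 i) (hC1 i) fun W hW => ?_
    filter_upwards [eventually_ball_subset_of_nhds hW] with l hl x hx
    exact hl (hCsub i l hx).2
  have hDpos : ∀ l, 0 < μ.real (D l) := fun l => ENNReal.toReal_pos (hD0 l) (hDfin l)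
  have hCpos : ∀ i l, 0 < μ.real (C i l) := fun i l => ENNReal.toReal_pos (hC0 i l) (hC1 i l)
  have hDzero : Tendsto (fun l => gram u v (D l)) atTop (𝓝 0) := by
    have hreal : Tendsto (fun l => ((μ.real (D l) : ℝ) : ℂ)) atTop (𝓝 0) := by
      rw [← Complex.ofReal_zero]
      refine (Complex.continuous_ofReal.tendsto 0).comp ?_
      refine squeeze_zero (fun l => (hDpos l).le) (fun l => ?_)
        (tendsto_one_div_add_atTop_nhds_zero_nat (𝕜 := ℝ))
      exact ((ENNReal.lt_ofReal_iff_toReal_lt (hDfin l)).1 (hD1 l)).le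
    have := hreal.smul hDavg
    rw [zero_smul] at this
    refine this.congr fun l => ?_
    have hne : ((μ.real (D l) : ℝ) : ℂ) ≠ 0 := by exact_mod_cast (hDpos l).ne'
    rw [smul_smul, Complex.ofReal_inv, mul_inv_cancel₀ hne, one_smul]
  have hmain : ∀ l, symmetrization (traceProd n m)
      (Function.update (fun i => gram u v (C i l)) i₀ (typeMatrix (p i₀))) = 0 := by
    intro l
    let B : ℕ → Fin m → Set X := fun s => Function.update (fun i => C i l) i₀ (D s)
    have hBm : ∀ s i, MeasurableSet (B s i) := by
      intro s i
      by_cases hi : i = i₀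
      · subst hi; simp only [B, Function.update_self]; exact hDm s
      · simp only [B, Function.update_of_ne hi]; exact hCm i l
    have hBU : ∀ s i, B s i ⊆ typeMap u v ⁻¹' U (p i) := by
      intro s i
      by_cases hi : i = i₀
      · subst hi; simp only [B, Function.update_self]; exact fun x hx => (hDsub s hx).1
      · simp only [B, Function.update_of_ne hi]; exact fun x hx => (hCsub i l hx).1
    have hBdisj : ∀ s, Pairwise fun i j => Disjoint (B s i) (B s j) := fun s i j hij =>
      ((hdisjU i j hij).preimage _).mono (hBU s i) (hBU s j)
    have hgramB : ∀ s, (fun i => gram u v (B s i)) =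
        Function.update (fun i => gram u v (C i l)) i₀ (gram u v (D s)) := by
      intro s
      funext i
      by_cases hi : i = i₀
      · subst hi; simp [B]
      · simp [B, hi]
    have hev : ∀ᶠ s in atTop, ∀ t : Finset (Fin m), i₀ ∉ t →
        ((∑ i ∈ insert i₀ t, gram u v (B s i)) ^ m).trace =
          ((∑ i ∈ t, gram u v (B s i)) ^ m).trace := by
      rw [eventually_all]
      intro t
      by_cases ht : i₀ ∈ t
      · exact Eventually.of_forall fun s h => absurd ht h
      have hsum : ∀ s, ∑ i ∈ t, gram u v (B s i) = ∑ i ∈ t, gram u v (C i l) := fun s =>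
        Finset.sum_congr rfl fun i hi => by
          have hne : i ≠ i₀ := fun h => ht (h ▸ hi)
          simp [B, hne]
      have htend : Tendsto (fun s => ((∑ i ∈ insert i₀ t, gram u v (B s i)) ^ m).trace) atTop
          (𝓝 ((∑ i ∈ t, gram u v (C i l)) ^ m).trace) := by
        have h1 : Tendsto (fun s => gram u v (D s) + ∑ i ∈ t, gram u v (C i l)) atTop
            (𝓝 (0 + ∑ i ∈ t, gram u v (C i l))) := hDzero.add tendsto_const_nhds
        rw [zero_add] at h1
        have hcont : Continuous fun A : Matrix (Fin n) (Fin n) ℂ => (A ^ m).trace :=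
          (continuous_pow m).matrix_trace
        refine ((hcont.tendsto _).comp h1).congr fun s => ?_
        simp only [Function.comp, Finset.sum_insert ht, hsum]
        simp [B]
      filter_upwards [eventually_eq_of_tendsto_of_finite (finite_trace_gram_pow hrep hinc hm)
        (fun s => ⟨⋃ i ∈ insert i₀ t, B s i, Finset.measurableSet_biUnion _ fun i _ => hBm s i,
          by rw [gram_biUnion _ (hBm s) (hBdisj s)]⟩) htend] with s hs _
      rw [hs, hsum]
    have hzero : ∀ᶠ s in atTop, symmetrization (traceProd n m)
        (Function.update (fun i => gram u v (C i l)) i₀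
          ((((μ.real (D s))⁻¹ : ℝ) : ℂ) • gram u v (D s))) = 0 := by
      filter_upwards [hev] with s hs
      rw [MultilinearMap.map_update_smul, ← hgramB s]
      rw [symmetrization_eq_zero _ _ i₀ fun t ht => by
        rw [traceProd_const, traceProd_const]; exact hs t ht, smul_zero]
    have hcontu : Continuous fun y => symmetrization (traceProd n m)
        (Function.update (fun i => gram u v (C i l)) i₀ y) :=
      (continuous_symmetrization_traceProd n m).comp (continuous_const.update i₀ continuous_id)
    -- Linearity in the slot `i₀` allowed division by `μ (D s)`, so the limit sees `typeMatrix (p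
    -- i₀)` although the Gram matrix itself tends to zero.
    exact tendsto_nhds_unique ((hcontu.tendsto _).comp hDavg)
      (tendsto_const_nhds.congr' (hzero.mono fun s hs => hs.symm))
  have hlim : Tendsto (fun l => fun i => Function.update
      (fun i => (((μ.real (C i l))⁻¹ : ℝ) : ℂ) • gram u v (C i l)) i₀ (typeMatrix (p i₀)) i) atTop
      (𝓝 fun i => typeMatrix (p i)) := by
    refine tendsto_pi_nhds.2 fun i => ?_
    by_cases hi : i = i₀
    · subst hi
      simp only [Function.update_self]
      exact tendsto_const_nhds
    · simp only [Function.update_of_ne hi]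
      exact hCavg i
  refine tendsto_nhds_unique
    (((continuous_symmetrization_traceProd n m).tendsto _).comp hlim) ?_
  refine tendsto_const_nhds.congr fun l => ?_
  have hscale : (fun i => Function.update
      (fun i => (((μ.real (C i l))⁻¹ : ℝ) : ℂ) • gram u v (C i l)) i₀ (typeMatrix (p i₀)) i) =
      fun i => Function.update (fun i => (((μ.real (C i l))⁻¹ : ℝ) : ℂ)) i₀ 1 i •
        Function.update (fun i => gram u v (C i l)) i₀ (typeMatrix (p i₀)) i := by
    funext i
    by_cases hi : i = i₀
    · subst hi; simp
    · simp [hi]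
  simp only [Function.comp]
  rw [hscale, MultilinearMap.map_smul_univ, hmain l, smul_zero]

theorem apply_ae_eq (hrep : ∀ h, K h = ∑ i, inner ℂ (v i) h • u i) (h : Lp ℂ 2 μ) :
    ∀ᵐ x ∂μ, K h x = ∑ i, inner ℂ (v i) h * u i x := by
  have hsum : ∀ s : Finset (Fin n), ∀ᵐ x ∂μ,
      (∑ i ∈ s, inner ℂ (v i) h • u i : Lp ℂ 2 μ) x = ∑ i ∈ s, inner ℂ (v i) h * u i x := by
    intro s
    induction s using Finset.induction_on with
    | empty =>
      filter_upwards [Lp.coeFn_zero ℂ 2 μ] with x hx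
      simpa using hx
    | insert a s ha ih =>
      rw [Finset.sum_insert ha]
      filter_upwards [ih, Lp.coeFn_add (inner ℂ (v a) h • u a) (∑ i ∈ s, inner ℂ (v i) h • u i),
        Lp.coeFn_smul (inner ℂ (v a) h) (u a)] with x h1 h2 h3
      rw [h2, Pi.add_apply, h3, h1, Finset.sum_insert ha, Pi.smul_apply, smul_eq_mul]
  rw [hrep h]
  exact hsum Finset.univ

theorem apply_ae_eq_on_pieces (hrep : ∀ h, K h = ∑ i, inner ℂ (v i) h • u i) {ι : Type*}
    [Fintype ι] {B : ι → Set X} (hB : ∀ j, MeasurableSet (B j))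
    (hdisj : Pairwise fun i j => Disjoint (B i) (B j)) {p : ι → KernelType n}
    (hp : ∀ j, B j ⊆ typeMap u v ⁻¹' {p j}) {h : Lp ℂ 2 μ}
    (hh : h ∈ standardSubspace μ (⋃ j, B j)) {c : ι → ℂ}
    (hc : ∀ j, ∀ᵐ x ∂μ, x ∈ B j → h x = c j) :
    ∀ᵐ x ∂μ, ∀ i, x ∈ B i → K h x = ∑ j, μ.real (B j) * c j * kern (p i) (p j) := by
  have hin : ∀ i, inner ℂ (v i) h = ∑ j, μ.real (B j) * c j * (p j).2 i := by
    intro i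
    have hE : MeasurableSet (⋃ j, B j) := MeasurableSet.iUnion hB
    rw [← standardProjection_eq_self hE hh, inner_standardProjection,
      integral_iUnion_fintype hB hdisj
        (fun j => (L2.integrable_inner (𝕜 := ℂ) (v i) h).integrableOn)]
    refine Finset.sum_congr rfl fun j _ => ?_
    have : ∫ x in B j, inner ℂ (v i x) (h x) ∂μ = ∫ _ in B j, c j * (p j).2 i ∂μ := by
      refine setIntegral_congr_ae (hB j) ?_
      filter_upwards [hc j] with x hx hxB
      have h2 : (typeMap u v x).2 i = (p j).2 i := by rw [show typeMap u v x = p j from hp j hxB]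
      rw [RCLike.inner_apply, hx hxB, ← h2]
      rfl
    rw [this, setIntegral_const, mul_assoc]
    rfl
  filter_upwards [apply_ae_eq hrep h] with x hx i hxi
  have h1 : ∀ k, u k x = (p i).1 k := fun k => by
    rw [← show typeMap u v x = p i from hp i hxi]
    rfl
  rw [hx]
  simp_rw [hin, h1, kern, dotProduct, Finset.mul_sum, Finset.sum_mul]
  rw [Finset.sum_comm]
  refine Finset.sum_congr rfl fun j _ => Finset.sum_congr rfl fun k _ => ?_
  ring

theorem exists_atom_of_not_isSmallType {S : Set X} (hS : IsCarrier μ S) {p : KernelType n}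
    (hp : p ∈ essTypes S u v) (hp0 : p.1 ≠ 0) (hsm : ¬ IsSmallType S u v p) :
    ∃ a ⊆ typeMap u v ⁻¹' {p} ∩ S, IsAtomOf (μ.restrict S) a ∧ μ a ≠ 0 ∧ μ a ≠ ∞ := by
  obtain ⟨h0, hfin, δ, hδ, hle⟩ := exists_le_measure_of_not_isSmallType hS hp hp0 hsm
  have hm : MeasurableSet (typeMap u v ⁻¹' {p}) := measurable_typeMap (measurableSet_singleton p)
  have hres : ∀ B ⊆ typeMap u v ⁻¹' {p} ∩ S, MeasurableSet B → μ.restrict S B = μ B := by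
    intro B hB hBm
    rw [Measure.restrict_apply hBm, Set.inter_eq_left.2 (hB.trans Set.inter_subset_right)]
  rw [Measure.restrict_apply hm] at h0 hfin
  have hmS := hm.inter hS.measurableSet
  obtain ⟨a, ha, hatom⟩ := exists_isAtomOf_subset (ν := μ.restrict S) hmS
    (by rwa [hres _ subset_rfl hmS]) (by rwa [hres _ subset_rfl hmS]) hδ
    (fun B hB hBm hB0 => by
      rw [hres B hB hBm] at hB0 ⊢
      exact hle B hB hBm hB0)
  refine ⟨a, ha, hatom, ?_, ne_top_of_le_ne_top hfin (measure_mono ha)⟩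
  rw [← hres a ha hatom.measurableSet]
  exact hatom.ne_zero

theorem ae_eq_const_of_subset {S a : Set X} (hS : IsCarrier μ S)
    (ha : IsAtomOf (μ.restrict S) a) (haS : a ⊆ S) (h : Lp ℂ 2 μ) :
    ∃ c : ℂ, ∀ᵐ x ∂μ, x ∈ a → h x = c := by
  obtain ⟨c, hc⟩ := ha.ae_eq_const (Lp.stronglyMeasurable h).measurable
  refine ⟨c, ?_⟩
  filter_upwards [(ae_restrict_iff' hS.measurableSet).1 hc] with x hx hxa
  exact hx (haS hxa) hxa

theorem eq_of_ae_on {a : Set X} (h0 : μ a ≠ 0) {c d : ℂ}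
    (h : ∀ᵐ x ∂μ, x ∈ a → c = d) : c = d := by
  by_contra hne
  refine h0 (measure_eq_zero_iff_ae_notMem.2 ?_)
  filter_upwards [h] with x hx hxa
  exact hne (hx hxa)

theorem mem_spectrum_compression_of_eigenvector (T : Lp ℂ 2 μ →L[ℂ] Lp ℂ 2 μ) {E : Set X}
    (hE : MeasurableSet E) {c : ℂ} {h : Lp ℂ 2 μ} (hh : h ∈ standardSubspace μ E) (h0 : h ≠ 0)
    (heq : standardProjection μ hE (T h) = c • h) : c ∈ spectrum ℂ (compression T hE) := by
  have hcomp : CompleteSpace (standardSubspace μ E) :=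
    (isClosed_standardSubspace hE).completeSpace_coe
  rw [ContinuousLinearMap.spectrum_eq]
  refine Module.End.HasEigenvalue.mem_spectrum
    (Module.End.hasEigenvalue_of_hasEigenvector (x := ⟨h, hh⟩)
      ⟨Module.End.mem_eigenspace_iff.2 (Subtype.ext heq), fun h1 => h0 (congrArg Subtype.val h1)⟩)

theorem standardProjection_eq_smul {E : Set X} (hE : MeasurableSet E) {f h : Lp ℂ 2 μ} {c : ℂ}
    (hh : h ∈ standardSubspace μ E) (hf : ∀ᵐ x ∂μ, x ∈ E → f x = c * h x) :
    standardProjection μ hE f = c • h := by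
  apply Lp.ext
  filter_upwards [standardProjection_coeFn μ hE f, hf, mem_standardSubspace.1 hh,
    Lp.coeFn_smul c h] with x h1 h2 h3 h4
  rw [h1, h4, Pi.smul_apply, smul_eq_mul]
  by_cases hx : x ∈ E
  · rw [Set.indicator_of_mem hx, h2 hx]
  · rw [Set.indicator_of_notMem hx, h3 hx, mul_zero]

/-- Functions are constant on each atom, hence determined by their integrals over the finitely many
atoms. -/
theorem finiteDimensional_standardSubspace_iUnion {S : Set X} (hS : IsCarrier μ S) {ι : Type*}
    [Fintype ι] {B : ι → Set X} (hB : ∀ j, IsAtomOf (μ.restrict S) (B j))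
    (hBS : ∀ j, B j ⊆ S) (h0 : ∀ j, μ (B j) ≠ 0) (hfin : ∀ j, μ (B j) ≠ ∞) :
    FiniteDimensional ℂ (standardSubspace μ (⋃ j, B j)) := by
  let L : Lp ℂ 2 μ →ₗ[ℂ] (ι → ℂ) := LinearMap.pi fun j =>
    (innerSL ℂ (indicatorConstLp 2 (hB j).measurableSet (hfin j) (1 : ℂ))).toLinearMap
  refine Module.Finite.of_injective (L.comp (standardSubspace μ (⋃ j, B j)).subtype) ?_
  rw [← LinearMap.ker_eq_bot, LinearMap.ker_eq_bot']
  rintro ⟨h, hh⟩ hL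
  refine Subtype.ext ((Lp.eq_zero_iff_ae_eq_zero).2 ?_)
  have hz : ∀ j, ∀ᵐ x ∂μ, x ∈ B j → h x = 0 := by
    intro j
    obtain ⟨c, hc⟩ := ae_eq_const_of_subset hS (hB j) (hBS j) h
    have h1 : inner ℂ (indicatorConstLp 2 (hB j).measurableSet (hfin j) (1 : ℂ)) h = 0 :=
      congrFun hL j
    rw [L2.inner_indicatorConstLp_one] at h1
    rw [setIntegral_congr_ae (hB j).measurableSet hc, setIntegral_const] at h1
    have hc0 : c = 0 := (smul_eq_zero.1 h1).resolve_left
      (ENNReal.toReal_pos (h0 j) (hfin j)).ne'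
    rwa [hc0] at hc
  filter_upwards [ae_all_iff.2 hz, mem_standardSubspace.1 hh] with x hx1 hx2
  by_cases hx : x ∈ ⋃ j, B j
  · obtain ⟨j, hj⟩ := Set.mem_iUnion.1 hx
    exact hx1 j hj
  · exact hx2 hx

/-- On the union of the atoms, the absence of chords leaves only diagonal entries and the entries
from each atom to its successor. The diagonal value `c₀` of the first atom must stay an eigenvalue.
Its equation at atom `0` forces the eigenvector to vanish at atom `1`, the next at atom `2`, and so
on around the cycle back to atom `0`. -/
theorem false_of_minimal_walk_of_atoms {S : Set X} (hS : IsCarrier μ S)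
    (hrep : ∀ h, K h = ∑ i, inner ℂ (v i) h • u i) (hinc : HasIncreasingSpectrum K)
    {m : ℕ} {w : ℕ → essTypes S u v}
    (hper : ∀ i, w (i + (m + 1)) = w i) (hw : ∀ i, Edge _ (w i) (w (i + 1)))
    (hmin : ∀ k < m + 1, ¬ HasPeriodicWalk (Edge (essTypes S u v)) k)
    (hsm : ∀ i, ¬ IsSmallType S u v (w i)) : False := by
  have hm : 0 < m := pos_of_walk hper hw
  have hex : ∀ i : Fin (m + 1), ∃ a ⊆ typeMap u v ⁻¹' {(w i : KernelType n)} ∩ S,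
      IsAtomOf (μ.restrict S) a ∧ μ a ≠ 0 ∧ μ a ≠ ∞ := by
    intro i
    refine exists_atom_of_not_isSmallType hS (w i).2 ?_ (hsm i)
    intro h0
    apply (hw i).2
    rw [kern, h0, zero_dotProduct]
  choose B hBsub hBat hB0 hBfin using hex
  have hBm : ∀ i, MeasurableSet (B i) := fun i => (hBat i).measurableSet
  have hBp : ∀ i, B i ⊆ typeMap u v ⁻¹' {(w i : KernelType n)} := fun i =>
    (hBsub i).trans Set.inter_subset_left
  have hBS : ∀ i, B i ⊆ S := fun i => (hBsub i).trans Set.inter_subset_right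
  have hdisj : Pairwise fun i j => Disjoint (B i) (B j) := by
    intro i j hij
    rw [Set.disjoint_left]
    intro x hxi hxj
    refine hij (Fin.ext (injOn_of_minimal_walk hper hw hmin i.2 j.2 (Subtype.ext ?_)))
    exact (show typeMap u v x = _ from hBp i hxi).symm.trans (hBp j hxj)
  set E := ⋃ j, B j with hEdef
  have hE : MeasurableSet E := MeasurableSet.iUnion hBm
  have hBE : ∀ i, B i ⊆ E := fun i => Set.subset_iUnion B i
  have hkern : ∀ i j : Fin (m + 1), j ≠ i → j ≠ i + 1 →
      kern (w i : KernelType n) (w j) = 0 := by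
    intro i j h1 h2
    refine kern_eq_zero_of_minimal_walk hper hw hmin i.2 j.2 (fun h => h1 (Fin.ext h.symm)) ?_
    rw [← periodic_fin_add_one hper i]
    exact fun h => h2 (Fin.ext (injOn_of_minimal_walk hper hw hmin j.2 (i + 1).2 h))
  set c₀ : ℂ := μ.real (B 0) * kern (w (0 : Fin (m + 1)) : KernelType n) (w (0 : Fin (m + 1)))
    with hc₀
  have hspec0 : c₀ ∈ spectrum ℂ (compression K (hBm 0)) := by
    have hne : standardSubspace μ (B 0) ≠ ⊥ := fun h =>
      (hBat 0).ne_zero ((hS.standardSubspace_eq_bot_iff (hBm 0)).1 h)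
    obtain ⟨h, hh, h0⟩ := Submodule.exists_mem_ne_zero_of_ne_bot hne
    obtain ⟨c, hc⟩ := ae_eq_const_of_subset hS (hBat 0) (hBS 0) h
    refine mem_spectrum_compression_of_eigenvector K (hBm 0) hh h0
      (standardProjection_eq_smul (hBm 0) hh ?_)
    have := apply_ae_eq_on_pieces hrep (ι := Unit) (B := fun _ => B 0) (fun _ => hBm 0)
      (fun i j hij => absurd (Subsingleton.elim i j) hij)
      (p := fun _ => (w (0 : Fin (m + 1)) : KernelType n)) (fun _ => hBp 0)
      (h := h) (by rwa [Set.iUnion_const]) (c := fun _ => c) (fun _ => hc)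
    filter_upwards [this, hc] with x hx1 hx2 hxB
    rw [hx1 () hxB, hx2 hxB, hc₀, Fintype.sum_unique]
    ring
  have hsub : standardSubspace μ (B 0) ≤ standardSubspace μ E := fun f hf => by
    filter_upwards [mem_standardSubspace.1 hf] with x hx hxE
    exact hx fun hxB => hxE (hBE 0 hxB)
  have hspec := hinc _ _ (hBm 0) hE hsub hspec0
  -- Since `c₀` may be zero, compactness does not yield an eigenvector; finite dimension does.
  have hfd : FiniteDimensional ℂ (standardSubspace μ E) :=
    finiteDimensional_standardSubspace_iUnion hS hBat hBS hB0 hBfin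
  have hcomp : CompleteSpace (standardSubspace μ E) :=
    (isClosed_standardSubspace hE).completeSpace_coe
  rw [ContinuousLinearMap.spectrum_eq, ← Module.End.hasEigenvalue_iff_mem_spectrum] at hspec
  obtain ⟨⟨h, hh⟩, hev⟩ := hspec.exists_hasEigenvector
  have hheq : standardProjection μ hE (K h) = c₀ • h := congrArg Subtype.val hev.apply_eq_smul
  have hh0 : h ≠ 0 := fun h0 => hev.2 (Subtype.ext h0)
  choose c hc using fun i => ae_eq_const_of_subset hS (hBat i) (hBS i) h
  have heqn : ∀ i : Fin (m + 1), ∑ j, μ.real (B j) * c j * kern (w i : KernelType n) (w j) = c₀ * c i := by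
    intro i
    refine eq_of_ae_on (hB0 i) ?_
    filter_upwards [apply_ae_eq_on_pieces hrep hBm hdisj
      (p := fun i => (w i : KernelType n)) hBp hh hc, hc i,
      standardProjection_coeFn μ hE (K h), Lp.coeFn_smul c₀ h] with x h1 h2 h3 h4 hxi
    rw [hheq, h4, Set.indicator_of_mem (hBE i hxi), h1 i hxi, Pi.smul_apply, h2 hxi,
      smul_eq_mul] at h3
    exact h3.symm
  -- In either case the diagonal term equals `c₀ * c i` and cancels, leaving a non-zero multiple of
  -- `c (i + 1)`.
  have hstep : ∀ i : Fin (m + 1), i = 0 ∨ c i = 0 → c (i + 1) = 0 := by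
    intro i hi
    have h1 := heqn i
    rw [Fintype.sum_eq_add i (i + 1) (fin_add_one_ne hm i)
      (fun j hj => by rw [hkern i j hj.1 hj.2, mul_zero])] at h1
    have h2 : (μ.real (B i) : ℂ) * c i * kern (w i : KernelType n) (w i) = c₀ * c i := by
      rcases hi with rfl | hi
      · rw [hc₀]
        ring
      · rw [hi]
        ring
    rw [h2, add_eq_left, periodic_fin_add_one hper i] at h1
    have h3 : (μ.real (B (i + 1)) : ℂ) ≠ 0 := by
      exact_mod_cast (ENNReal.toReal_pos (hB0 (i + 1)) (hBfin (i + 1))).ne'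
    rcases mul_eq_zero.1 h1 with h4 | h4
    · exact (mul_eq_zero.1 h4).resolve_left h3
    · exact absurd h4 (hw i).2
  have hsuc : ∀ i : Fin (m + 1), c (i + 1) = 0 := by
    intro i
    induction i using Fin.induction with
    | zero => exact hstep _ (Or.inl rfl)
    | succ i ih => exact hstep _ (Or.inr (by rwa [Fin.coeSucc_eq_succ] at ih))
  have hall : ∀ i, c i = 0 := by
    intro i
    have := hsuc (i - 1)
    rwa [sub_add_cancel] at this
  apply hh0
  rw [Lp.eq_zero_iff_ae_eq_zero]
  filter_upwards [ae_all_iff.2 hc, mem_standardSubspace.1 hh] with x hx1 hx2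
  by_cases hx : x ∈ E
  · obtain ⟨j, hj⟩ := Set.mem_iUnion.1 hx
    rw [hx1 j hj, hall j]
    rfl
  · exact hx2 hx

theorem not_hasPeriodicWalk {S : Set X} (hS : IsCarrier μ S)
    (hrep : ∀ h, K h = ∑ i, inner ℂ (v i) h • u i) (hinc : HasIncreasingSpectrum K) (m : ℕ) :
    ¬ HasPeriodicWalk (Edge (essTypes S u v)) m := by
  induction m using Nat.strong_induction_on with
  | _ m hmin =>
    rintro ⟨hm, w, hper, hw⟩
    obtain ⟨m, rfl⟩ := Nat.exists_eq_succ_of_ne_zero hm.ne'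
    by_cases hsm : ∃ i : Fin (m + 1), IsSmallType S u v (w i)
    · obtain ⟨i, hi⟩ := hsm
      refine symmetrization_traceProd_ne_zero hper hw hmin
        (symmetrization_traceProd_eq_zero_of_isSmallType hS hrep hinc hm
          (p := fun i : Fin (m + 1) => (w i : KernelType n)) (fun i => (w i).2) ?_ i hi)
      intro i j hij
      exact Fin.ext (injOn_of_minimal_walk hper hw hmin i.2 j.2 (Subtype.ext hij))
    · push Not at hsm
      refine false_of_minimal_walk_of_atoms hS hrep hinc hper hw hmin fun i => ?_
      have hmod : w i = w (i % (m + 1)) := by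
        have hp : Function.Periodic w (m + 1) := hper
        exact (hp.map_mod_nat i).symm
      rw [hmod]
      exact hsm ⟨i % (m + 1), Nat.mod_lt _ m.succ_pos⟩

/-! ### Sorting an acyclic kernel into levels -/

/-- The pairings would form an invertible triangular matrix of size `n + 1` that factors through
`ℂⁿ`. -/
theorem false_of_triangular_pairing {P Q : Fin (n + 1) → KernelType n}
    (hzero : ∀ a b, a < b → kern (P a) (Q b) = 0) (hdiag : ∀ a, kern (P a) (Q a) ≠ 0) :
    False := by
  let F : Matrix (Fin (n + 1)) (Fin n) ℂ := Matrix.of fun a i => (P a).1 i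
  let G : Matrix (Fin n) (Fin (n + 1)) ℂ := Matrix.of fun i b => (Q b).2 i
  have hFG : ∀ a b, (F * G) a b = kern (P a) (Q b) := fun a b => rfl
  have hdet : (F * G).det ≠ 0 := by
    rw [Matrix.det_of_isLowerTriangular (F * G) fun a b hab => by
      rw [hFG]; exact hzero a b (OrderDual.toDual_lt_toDual.1 hab)]
    exact Finset.prod_ne_zero_iff.2 fun a _ => hdiag a
  have h1 : (F * G).rank = n + 1 := by
    rw [Matrix.rank_of_isUnit _ ((Matrix.isUnit_iff_isUnit_det _).2 hdet.isUnit), Fintype.card_fin]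
  have h2 := (Matrix.rank_mul_le_left F G).trans (Matrix.rank_le_card_width F)
  rw [h1, Fintype.card_fin] at h2
  omega

/-- Every column of the kernel on `S` is non-zero. -/
def NoZeroColumn (S : Set (KernelType n)) : Prop := ∀ q ∈ S, ∃ p ∈ S, kern p q ≠ 0

/-- Otherwise every type in `S` has a predecessor different from itself, which yields an infinite
backward walk. Acyclicity makes the pairings along it triangular, exceeding the rank bound. -/
theorem exists_isolated_loop {R : Set (KernelType n)}
    (hac : ∀ m, ¬ HasPeriodicWalk (Edge R) m) {S : Set (KernelType n)} (hSR : S ⊆ R)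
    (hne : S.Nonempty) (hS : NoZeroColumn S) :
    ∃ a ∈ S, kern a a ≠ 0 ∧ ∀ p ∈ S, p ≠ a → kern p a = 0 := by
  by_contra! hcon
  have hpred : ∀ q : S, ∃ p : S, (p : KernelType n) ≠ q ∧ kern (p : KernelType n) q ≠ 0 := by
    rintro ⟨q, hq⟩
    obtain ⟨p, hp, hpq⟩ := hS q hq
    by_cases h : p = q
    · subst h
      obtain ⟨p', hp', hne, hk⟩ := hcon p hp hpq
      exact ⟨⟨p', hp'⟩, hne, hk⟩
    · exact ⟨⟨p, hp⟩, h, hpq⟩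
  choose f hf using hpred
  let g : ℕ → S := fun i => f^[i] ⟨hne.some, hne.some_mem⟩
  let q : ℕ → R := fun i => ⟨g i, hSR (g i).2⟩
  have hedge : ∀ i, Edge R (q (i + 1)) (q i) := by
    intro i
    have := hf (g i)
    have hg : g (i + 1) = f (g i) := Function.iterate_succ_apply' f i _
    rw [← hg] at this
    exact ⟨fun h => this.1 (congrArg (fun z : R => (z : KernelType n)) h), this.2⟩
  have hback : ∀ j i, j ≤ i → ¬ Edge R (q j) (q i) := by
    intro j i hji h
    refine hac (i - j + 1) (hasPeriodicWalk_of_segment (fun t => q (i - t)) 0 (i - j) ?_ ?_)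
    · intro t ht
      have := hedge (i - (0 + t + 1))
      rwa [show i - (0 + t + 1) + 1 = i - (0 + t) by omega] at this
    · have h1 : i - (0 + (i - j)) = j := by omega
      simpa only [h1, Nat.sub_zero] using h
  have hzero : ∀ j i, j < i → kern (q j : KernelType n) (q i) = 0 := by
    intro j i hji
    by_contra hk
    by_cases heq : q j = q i
    · have := hedge j
      rw [heq] at this
      exact hback _ _ hji this
    · exact hback j i hji.le ⟨heq, hk⟩
  -- Taking every second edge avoids the pairings `kern (q i) (q i)`, about which nothing is known.
  exact false_of_triangular_pairing
    (P := fun a => (q (2 * a + 1) : KernelType n)) (Q := fun a => (q (2 * a) : KernelType n))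
    (fun a b hab => hzero _ _ (by have := Fin.lt_def.1 hab; omega)) (fun a => (hedge _).2)

/-- Restriction of functions to a set, extended by zero. -/
def indicatorMap (S : Set (KernelType n)) : (KernelType n → ℂ) →ₗ[ℂ] (KernelType n → ℂ) where
  toFun f := S.indicator f
  map_add' f g := Set.indicator_add S f g
  map_smul' c f := Set.indicator_const_smul S c f

/-- The pairing with a fixed vector, as a function of the kernel type. -/
def pairingMap : (Fin n → ℂ) →ₗ[ℂ] (KernelType n → ℂ) where
  toFun z p := p.1 ⬝ᵥ z
  map_add' z w := by ext p; exact dotProduct_add _ _ _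
  map_smul' c z := by ext p; exact dotProduct_smul _ _ _

/-- The span of the columns of the kernel on `S`. -/
def columnSpan (S : Set (KernelType n)) : Submodule ℂ (KernelType n → ℂ) :=
  ((Submodule.span ℂ (Prod.snd '' S)).map pairingMap).map (indicatorMap S)

instance (S : Set (KernelType n)) : FiniteDimensional ℂ (columnSpan S) := by
  unfold columnSpan
  infer_instance

theorem finrank_columnSpan_le (S : Set (KernelType n)) : Module.finrank ℂ (columnSpan S) ≤ n := by
  refine (Submodule.finrank_map_le _ _).trans ((Submodule.finrank_map_le _ _).trans ?_)
  exact (Submodule.finrank_le _).trans_eq (by simp)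

theorem columnSpan_le_map {S' S : Set (KernelType n)} (h : S' ⊆ S) :
    columnSpan S' ≤ (columnSpan S).map (indicatorMap S') := by
  have hcomp : (indicatorMap S').comp (indicatorMap S) = indicatorMap S' := by
    ext f p
    simp [indicatorMap, Set.indicator_indicator, Set.inter_eq_left.2 h]
  rw [columnSpan, columnSpan, ← Submodule.map_comp (indicatorMap S) (indicatorMap S'), hcomp]
  exact Submodule.map_mono (Submodule.map_mono (Submodule.span_mono (Set.image_mono h)))

theorem finrank_columnSpan_mono {S' S : Set (KernelType n)} (h : S' ⊆ S) :
    Module.finrank ℂ (columnSpan S') ≤ Module.finrank ℂ (columnSpan S) :=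
  (Submodule.finrank_mono (columnSpan_le_map h)).trans (Submodule.finrank_map_le _ _)

/-- Restriction from `S` to `S'` maps the column span of `S` onto a space containing that of `S'`,
and it kills the column of `q`, which is non-zero on `S`. -/
theorem finrank_columnSpan_lt {S' S : Set (KernelType n)} (h : S' ⊆ S) {p q : KernelType n}
    (hp : p ∈ S) (hq : q ∈ S) (hpq : kern p q ≠ 0) (hzero : ∀ p' ∈ S', kern p' q = 0) :
    Module.finrank ℂ (columnSpan S') < Module.finrank ℂ (columnSpan S) := by
  refine (Submodule.finrank_mono (columnSpan_le_map h)).trans_lt ?_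
  have hmem : indicatorMap S (pairingMap q.2) ∈ columnSpan S :=
    Submodule.mem_map_of_mem (Submodule.mem_map_of_mem (Submodule.subset_span ⟨q, hq, rfl⟩))
  have hne : indicatorMap S (pairingMap q.2) ≠ 0 := by
    intro h0
    have := congrFun h0 p
    change S.indicator (pairingMap q.2) p = 0 at this
    rw [Set.indicator_of_mem hp] at this
    exact hpq this
  have hker : indicatorMap S' (indicatorMap S (pairingMap q.2)) = 0 := by
    ext p'
    change S'.indicator (S.indicator (pairingMap q.2)) p' = 0
    by_cases hp' : p' ∈ S'
    · rw [Set.indicator_of_mem hp', Set.indicator_of_mem (h hp')]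
      exact hzero p' hp'
    · rw [Set.indicator_of_notMem hp']
  let L := (indicatorMap S').domRestrict (columnSpan S)
  have hrange : LinearMap.range L = (columnSpan S).map (indicatorMap S') :=
    LinearMap.range_domRestrict _ _
  have hadd := L.finrank_range_add_finrank_ker
  rw [hrange] at hadd
  have hpos : 0 < Module.finrank ℂ (LinearMap.ker L) := by
    refine Nat.pos_of_ne_zero fun h0 => hne ?_
    have hmemK : (⟨_, hmem⟩ : columnSpan S) ∈ LinearMap.ker L := hker
    rw [Submodule.finrank_eq_zero.1 h0, Submodule.mem_bot] at hmemK
    exact congrArg Subtype.val hmemK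
  omega

/-- The function `ℓ` orders the kernel types in `S` triangularly, with values less than `M`. -/
structure IsLevelFunction (S : Set (KernelType n)) (ℓ : KernelType n → ℕ) (M : ℕ) : Prop where
  measurable : Measurable ℓ
  lt : ∀ p ∈ S, ℓ p < M
  triangular : ∀ p ∈ S, ∀ q ∈ S, kern p q ≠ 0 → ℓ p < ℓ q ∨ p = q
  eq_of_loop : ∀ p ∈ S, ∀ q ∈ S, kern p p ≠ 0 → ℓ p = ℓ q → p = q

-- The set `Z` becomes the new lowest level: nothing in `S` pairs into an element of `Z` except
-- possibly that element itself.
open Classical in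
theorem IsLevelFunction.cons {S Z : Set (KernelType n)} {ℓ : KernelType n → ℕ} {M : ℕ}
    (h : IsLevelFunction (S \ Z) ℓ M) (hZ : MeasurableSet Z)
    (hcol : ∀ q ∈ Z, ∀ p ∈ S, p ≠ q → kern p q = 0)
    (hloop : ∀ p ∈ Z, ∀ q ∈ Z, kern p p ≠ 0 → p = q) :
    IsLevelFunction S (fun p => if p ∈ Z then 0 else ℓ p + 1) (M + 1) := by
  refine ⟨Measurable.ite hZ measurable_const (h.measurable.add_const 1), ?_, ?_, ?_⟩
  · intro p hp
    by_cases hpZ : p ∈ Z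
    · simp [hpZ]
    · simp only [hpZ, if_false]
      exact Nat.succ_lt_succ (h.lt p ⟨hp, hpZ⟩)
  · intro p hp q hq hpq
    by_cases hqZ : q ∈ Z
    · right
      by_contra hne
      exact hpq (hcol q hqZ p hp hne)
    · by_cases hpZ : p ∈ Z
      · left
        simp [hpZ, hqZ]
      · simp only [hpZ, hqZ, if_false, Nat.add_lt_add_iff_right]
        exact h.triangular p ⟨hp, hpZ⟩ q ⟨hq, hqZ⟩ hpq
  · intro p hp q hq hpp heq
    by_cases hpZ : p ∈ Z <;> by_cases hqZ : q ∈ Z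
    · exact hloop p hpZ q hqZ hpp
    · simp [hpZ, hqZ] at heq
    · simp [hpZ, hqZ] at heq
    · simp only [hpZ, hqZ, if_false, Nat.add_right_cancel_iff] at heq
      exact h.eq_of_loop p ⟨hp, hpZ⟩ q ⟨hq, hqZ⟩ hpp heq

theorem isClosed_setOf_column_eq_zero (S : Set (KernelType n)) :
    IsClosed {q : KernelType n | ∀ p ∈ S, kern p q = 0} := by
  have : {q : KernelType n | ∀ p ∈ S, kern p q = 0} = ⋂ p ∈ S, {q | kern p q = 0} := by
    ext q
    simp
  rw [this]
  exact isClosed_biInter fun p _ =>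
    isClosed_eq (continuous_kern.comp (continuous_const.prodMk continuous_id)) continuous_const

/-- Without zero columns, removing an isolated loop costs one level and lowers the rank, giving `1 +
(2(r - 1) + 1) = 2r`. In general, removing the zero columns costs one level; the remainder either
has no zero column, and needs `2r`, or has a new one, which means the rank has already dropped. -/
theorem exists_isLevelFunction_of_finrank_le {R : Set (KernelType n)}
    (hac : ∀ m, ¬ HasPeriodicWalk (Edge R) m) (r : ℕ) :
    ∀ S ⊆ R, MeasurableSet S → Module.finrank ℂ (columnSpan S) ≤ r →
      ∃ ℓ M, IsLevelFunction S ℓ M ∧ M ≤ 2 * r + 1 ∧ (NoZeroColumn S → M ≤ 2 * r) := by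
  classical
  induction r using Nat.strong_induction_on with
  | _ r ih =>
    have hrec : ∀ S ⊆ R, MeasurableSet S → Module.finrank ℂ (columnSpan S) < r →
        ∃ ℓ M, IsLevelFunction S ℓ M ∧ M + 1 ≤ 2 * r := by
      intro S hSR hS hlt
      obtain ⟨ℓ, M, h1, h2, -⟩ := ih _ hlt S hSR hS le_rfl
      exact ⟨ℓ, M, h1, by omega⟩
    have hnz : ∀ S ⊆ R, MeasurableSet S → Module.finrank ℂ (columnSpan S) ≤ r →
        NoZeroColumn S → ∃ ℓ M, IsLevelFunction S ℓ M ∧ M ≤ 2 * r := by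
      intro S hSR hS hr hno
      rcases S.eq_empty_or_nonempty with rfl | hne
      · exact ⟨fun _ => 0, 0, ⟨measurable_const, by simp, by simp, by simp⟩, Nat.zero_le _⟩
      obtain ⟨a, ha, haa, hcol⟩ := exists_isolated_loop hac hSR hne hno
      obtain ⟨ℓ, M, h1, h2⟩ := hrec (S \ {a}) (Set.sdiff_subset.trans hSR)
        (hS.diff (measurableSet_singleton a))
        ((finrank_columnSpan_lt Set.sdiff_subset ha ha haa
          fun p hp => hcol p hp.1 hp.2).trans_le hr)
      refine ⟨_, M + 1, h1.cons (measurableSet_singleton a) ?_ ?_, h2⟩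
      · rintro q rfl p hp hne
        exact hcol p hp hne
      · rintro p rfl q rfl -
        rfl
    intro S hSR hS hr
    by_cases hno : NoZeroColumn S
    · obtain ⟨ℓ, M, h1, h2⟩ := hnz S hSR hS hr hno
      exact ⟨ℓ, M, h1, by omega, fun _ => h2⟩
    let Z := S ∩ {q | ∀ p ∈ S, kern p q = 0}
    have hZ : MeasurableSet Z := hS.inter (isClosed_setOf_column_eq_zero S).measurableSet
    have hex : ∃ ℓ M, IsLevelFunction (S \ Z) ℓ M ∧ M ≤ 2 * r := by
      by_cases hno' : NoZeroColumn (S \ Z)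
      · exact hnz _ (Set.sdiff_subset.trans hSR) (hS.diff hZ)
          ((finrank_columnSpan_mono Set.sdiff_subset).trans hr) hno'
      · unfold NoZeroColumn at hno'
        push Not at hno'
        obtain ⟨q, hq, hq0⟩ := hno'
        have hqZ : ¬ ∀ p ∈ S, kern p q = 0 := fun h => hq.2 ⟨hq.1, h⟩
        push Not at hqZ
        obtain ⟨p, hp, hpq⟩ := hqZ
        obtain ⟨ℓ, M, h1, h2⟩ := hrec (S \ Z) (Set.sdiff_subset.trans hSR) (hS.diff hZ)
          ((finrank_columnSpan_lt Set.sdiff_subset hp hq.1 hpq hq0).trans_le hr)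
        exact ⟨ℓ, M, h1, by omega⟩
    obtain ⟨ℓ, M, h1, h2⟩ := hex
    refine ⟨_, M + 1, h1.cons hZ ?_ ?_, by omega, fun h => absurd h hno⟩
    · exact fun q hq p hp _ => hq.2 p hp
    · exact fun p hp q _ hpp => absurd (hp.2 p hp.1) hpp

theorem exists_isLevelFunction {R : Set (KernelType n)}
    (hac : ∀ m, ¬ HasPeriodicWalk (Edge R) m) (hR : MeasurableSet R) :
    ∃ ℓ, IsLevelFunction R ℓ (2 * n + 1) := by
  obtain ⟨ℓ, M, h1, h2, -⟩ := exists_isLevelFunction_of_finrank_le hac n R subset_rfl hR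
    (finrank_columnSpan_le R)
  exact ⟨ℓ, h1.measurable, fun p hp => (h1.lt p hp).trans_le h2, h1.triangular, h1.eq_of_loop⟩

/-! ### The block triangular partition -/

/-- For almost every `x`, `K h x` is the integral of `h y * kern (type x) (type y)` in `y`, and the
integrand vanishes almost everywhere when `x ∈ A`. -/
theorem apply_ae_eq_zero_of_kern_eq_zero {S : Set X} (hS : IsCarrier μ S)
    (hrep : ∀ h, K h = ∑ i, inner ℂ (v i) h • u i) {A B : Set X} {h : Lp ℂ 2 μ}
    (hh : h ∈ standardSubspace μ B)
    (hAB : ∀ᵐ x ∂μ.restrict S, x ∈ A → ∀ᵐ y ∂μ.restrict S, y ∈ B →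
      kern (typeMap u v x) (typeMap u v y) = 0) :
    ∀ᵐ x ∂μ, x ∈ A → K h x = 0 := by
  filter_upwards [apply_ae_eq hrep h, (ae_restrict_iff' hS.measurableSet).1 hAB,
    hS.vanish (K h)] with x h1 h2 h3 hxA
  by_cases hxS : x ∈ S
  · rw [h1]
    have h4 : ∑ i, inner ℂ (v i) h * u i x =
        ∫ y, ∑ i, inner ℂ (v i y) (h y) * u i x ∂μ := by
      rw [integral_finsetSum]
      · refine Finset.sum_congr rfl fun i _ => ?_
        rw [integral_mul_const, L2.inner_def]
      · exact fun i _ => (L2.integrable_inner (𝕜 := ℂ) (v i) h).mul_const _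
    rw [h4]
    refine integral_eq_zero_of_ae ?_
    filter_upwards [(ae_restrict_iff' hS.measurableSet).1 (h2 hxS hxA), hS.vanish h,
      mem_standardSubspace.1 hh] with y hy1 hy2 hy3
    have h5 : ∑ i, inner ℂ (v i y) (h y) * u i x =
        h y * kern (typeMap u v x) (typeMap u v y) := by
      rw [kern, dotProduct, Finset.mul_sum]
      refine Finset.sum_congr rfl fun i _ => ?_
      rw [RCLike.inner_apply]
      simp only [typeMap, RCLike.star_def]
      ring
    rw [h5]
    by_cases hyS : y ∈ S
    · by_cases hyB : y ∈ B
      · rw [hy1 hyS hyB, mul_zero]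
        rfl
      · rw [hy3 hyB, zero_mul]
        rfl
    · rw [hy2 hyS, zero_mul]
      rfl
  · exact h3 hxS

theorem block_eq_zero {S : Set X} (hS : IsCarrier μ S)
    (hrep : ∀ h, K h = ∑ i, inner ℂ (v i) h • u i) {A B : Set X} (hA : MeasurableSet A)
    (hAB : ∀ᵐ x ∂μ.restrict S, x ∈ A → ∀ᵐ y ∂μ.restrict S, y ∈ B →
      kern (typeMap u v x) (typeMap u v y) = 0) : block K hA B = 0 := by
  ext1 h
  refine Subtype.ext ?_
  change standardProjection μ hA (K h) = 0
  rw [Lp.eq_zero_iff_ae_eq_zero]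
  filter_upwards [standardProjection_coeFn μ hA (K h),
    apply_ae_eq_zero_of_kern_eq_zero hS hrep h.2 hAB] with x h1 h2
  rw [h1]
  by_cases hx : x ∈ A
  · rw [Set.indicator_of_mem hx, h2 hx]
    rfl
  · rw [Set.indicator_of_notMem hx]
    rfl

theorem exists_smul_of_finrank_eq_one {V : Type*} [AddCommGroup V] [Module ℂ V]
    (h : Module.finrank ℂ V = 1) (T : V →ₗ[ℂ] V) : ∃ c : ℂ, ∀ x, T x = c • x := by
  obtain ⟨x₀, -, hx₀⟩ := finrank_eq_one_iff'.1 h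
  obtain ⟨c, hc⟩ := hx₀ (T x₀)
  refine ⟨c, fun x => ?_⟩
  obtain ⟨d, rfl⟩ := hx₀ x
  rw [map_smul, ← hc, smul_comm]

theorem exists_block_triangular_partition {S : Set X} (hS : IsCarrier μ S)
    (hrep : ∀ h, K h = ∑ i, inner ℂ (v i) h • u i) (hinc : HasIncreasingSpectrum K)
    (hK : K ≠ 0) {ℓ : KernelType n → ℕ} {M : ℕ} (hℓ : IsLevelFunction (essTypes S u v) ℓ M) :
    ∃ (m : ℕ) (E : Fin m → Set X) (hE : ∀ j, MeasurableSet (E j)),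
      1 ≤ m ∧ m ≤ M ∧
      Pairwise (fun i j => Disjoint (E i) (E j)) ∧ (⋃ j, E j) = Set.univ ∧
      (∀ j, standardSubspace μ (E j) ≠ ⊥) ∧
      (∀ i j, j < i → block K (hE i) (E j) = 0) ∧
      (∀ j, block K (hE j) (E j) ≠ 0 →
        Module.finrank ℂ (standardSubspace μ (E j)) = 1 ∧
        ∃ c : ℂ, c ≠ 0 ∧ Module.End.HasEigenvalue K.toLinearMap c ∧
          block K (hE j) (E j) =
            c • ContinuousLinearMap.id ℂ (standardSubspace μ (E j))) := by
  classical
  let lev : X → ℕ := fun x => ℓ (typeMap u v x)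
  have hlev : Measurable lev := hℓ.measurable.comp measurable_typeMap
  have hR := ae_typeMap_mem_essTypes (u := u) (v := v) S
  let J : Finset ℕ := (Finset.range M).filter fun k => μ.restrict S (lev ⁻¹' {k}) ≠ 0
  have hJ : ∀ᵐ x ∂μ.restrict S, lev x ∈ J := by
    have hnull : ∀ᵐ x ∂μ.restrict S, ∀ k : ℕ, μ.restrict S (lev ⁻¹' {k}) = 0 → lev x ≠ k := by
      rw [ae_all_iff]
      intro k
      by_cases hk : μ.restrict S (lev ⁻¹' {k}) = 0
      · filter_upwards [measure_eq_zero_iff_ae_notMem.1 hk] with x hx _ hxk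
        exact hx hxk
      · exact Eventually.of_forall fun x h => absurd h hk
    filter_upwards [hR, hnull] with x hx1 hx2
    exact Finset.mem_filter.2 ⟨Finset.mem_range.2 (hℓ.lt _ hx1), fun h => hx2 _ h rfl⟩
  have hJne : J.Nonempty := by
    by_contra hempty
    rw [Finset.not_nonempty_iff_eq_empty] at hempty
    have huniv : μ.restrict S Set.univ = 0 := by
      rw [measure_eq_zero_iff_ae_notMem]
      filter_upwards [hJ] with x hx
      rw [hempty] at hx
      exact absurd hx (Finset.notMem_empty _)
    apply hK
    ext1 h
    have hmem : K h ∈ standardSubspace μ (Set.univ : Set X) := by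
      rw [standardSubspace_univ]
      exact Submodule.mem_top
    rw [(hS.standardSubspace_eq_bot_iff MeasurableSet.univ).2 huniv] at hmem
    exact (Submodule.mem_bot ℂ).1 hmem
  let e := J.orderIsoOfFin rfl
  -- Null levels are dropped and the others renumbered. Points at a dropped level go to the first
  -- block; on the carrier they form a null set.
  let idx : ℕ → Fin J.card := fun k =>
    if hk : k ∈ J then e.symm ⟨k, hk⟩ else ⟨0, Finset.card_pos.2 hJne⟩
  have hidx_lt : ∀ a ∈ J, ∀ b ∈ J, idx a < idx b ↔ a < b := by
    intro a ha b hb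
    simp only [idx, dif_pos ha, dif_pos hb, OrderIso.lt_iff_lt]
    rfl
  have hidx_inj : ∀ a ∈ J, ∀ b ∈ J, idx a = idx b → a = b := by
    intro a ha b hb h
    simp only [idx, dif_pos ha, dif_pos hb] at h
    exact congrArg Subtype.val (e.symm.injective h)
  have hidx_e : ∀ j, idx (e j) = j := by
    intro j
    simp only [idx, dif_pos (e j).2]
    exact e.symm_apply_apply j
  let E : Fin J.card → Set X := fun j => {x | idx (lev x) = j}
  have hE : ∀ j, MeasurableSet (E j) := fun j => by
    have h1 : Measurable fun x => idx (lev x) := (Measurable.of_discrete (f := idx)).comp hlev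
    exact h1 (measurableSet_singleton j)
  have hEne : ∀ j, μ.restrict S (E j) ≠ 0 := by
    intro j h0
    refine (Finset.mem_filter.1 (e j).2).2 (measure_mono_null ?_ h0)
    intro x hx
    change idx (lev x) = j
    rw [show lev x = e j from hx, hidx_e]
  refine ⟨J.card, E, hE, Finset.card_pos.2 hJne, ?_, ?_, ?_, ?_, ?_, ?_⟩
  · exact (Finset.card_filter_le _ _).trans_eq (Finset.card_range M)
  · intro i j hij
    rw [Set.disjoint_left]
    intro x hxi hxj
    exact hij ((show idx (lev x) = i from hxi).symm.trans hxj)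
  · exact Set.eq_univ_iff_forall.2 fun x => Set.mem_iUnion.2 ⟨idx (lev x), rfl⟩
  · exact fun j h => hEne j ((hS.standardSubspace_eq_bot_iff (hE j)).1 h)
  · intro i j hji
    refine block_eq_zero hS hrep (hE i) ?_
    filter_upwards [hR, hJ] with x hxR hxJ hxi
    filter_upwards [hR, hJ] with y hyR hyJ hyj
    by_contra hk
    have hxi' : idx (lev x) = i := hxi
    have hyj' : idx (lev y) = j := hyj
    rcases hℓ.triangular _ hxR _ hyR hk with h | h
    · have h1 := (hidx_lt _ hxJ _ hyJ).2 h
      rw [hxi', hyj'] at h1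
      exact absurd h1 (not_lt.2 hji.le)
    · have h1 : lev x = lev y := congrArg ℓ h
      rw [h1, hyj'] at hxi'
      exact hji.ne hxi'
  · intro j hblock
    -- A non-zero pairing inside one level forces equal types, hence a loop; without one the
    -- diagonal block would vanish. With one, the level is the fibre of that type up to a null set,
    -- which is an atom.
    have hloop : ∃ p ∈ essTypes S u v, ℓ p = e j ∧ kern p p ≠ 0 := by
      by_contra! hcon
      refine hblock (block_eq_zero hS hrep (hE j) ?_)
      filter_upwards [hR, hJ] with x hxR hxJ hxj
      filter_upwards [hR, hJ] with y hyR hyJ hyj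
      have hxy : idx (lev x) = idx (lev y) :=
        (show idx (lev x) = j from hxj).trans (show idx (lev y) = j from hyj).symm
      have hlevx : lev x = e j := hidx_inj _ hxJ _ (e j).2
        ((show idx (lev x) = j from hxj).trans (hidx_e j).symm)
      by_contra hk
      rcases hℓ.triangular _ hxR _ hyR hk with h | h
      · exact absurd (hidx_inj _ hxJ _ hyJ hxy) h.ne
      · rw [← h] at hk
        exact hk (hcon _ hxR hlevx)
    obtain ⟨p, hpR, hpj, hpp⟩ := hloop
    have hatom := isAtomOf_preimage_of_loop hS hrep hinc hpR hpp
    have hEeq : standardSubspace μ (E j) = standardSubspace μ (typeMap u v ⁻¹' {p}) := by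
      refine le_antisymm ((hS.standardSubspace_le_iff (hE j) hatom.measurableSet).2 ?_)
        ((hS.standardSubspace_le_iff hatom.measurableSet (hE j)).2 ?_)
      · rw [measure_eq_zero_iff_ae_notMem]
        filter_upwards [hR, hJ] with x hxR hxJ hx
        have hlevx : lev x = e j := hidx_inj _ hxJ _ (e j).2
          ((show idx (lev x) = j from hx.1).trans (hidx_e j).symm)
        exact hx.2 (hℓ.eq_of_loop p hpR _ hxR hpp (hpj.trans hlevx.symm)).symm
      · have : typeMap u v ⁻¹' {p} \ E j = ∅ := by
          rw [Set.sdiff_eq_empty]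
          intro x hx
          change idx (ℓ (typeMap u v x)) = j
          rw [show typeMap u v x = p from hx, hpj, hidx_e]
        rw [this, measure_empty]
    have hfr : Module.finrank ℂ (standardSubspace μ (E j)) = 1 := by
      rw [hEeq]
      exact hatom.finrank_eq_one hS
    obtain ⟨c, hc⟩ := exists_smul_of_finrank_eq_one hfr (block K (hE j) (E j)).toLinearMap
    have hblock_eq : block K (hE j) (E j) =
        c • ContinuousLinearMap.id ℂ (standardSubspace μ (E j)) := by
      ext1 x
      exact hc x
    have hc0 : c ≠ 0 := by
      rintro rfl
      exact hblock (by ext1 x; exact (hc x).trans (zero_smul ℂ x))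
    refine ⟨hfr, c, hc0, ?_, hblock_eq⟩
    have hne : standardSubspace μ (E j) ≠ ⊥ := fun h =>
      hEne j ((hS.standardSubspace_eq_bot_iff (hE j)).1 h)
    obtain ⟨h, hh, h0⟩ := Submodule.exists_mem_ne_zero_of_ne_bot hne
    exact hasEigenvalue_of_mem_spectrum_compression hrep hinc (hE j) hc0
      (mem_spectrum_compression_of_eigenvector K (hE j) hh h0
        (congrArg Subtype.val (hc ⟨h, hh⟩)))

/-! ### The algebra of multiplication operators -/

/-- The operator `A` is the multiplication by the function `φ`. -/
def IsMultiplicationBy (A : Lp ℂ 2 μ →L[ℂ] Lp ℂ 2 μ) (φ : X → ℂ) : Prop :=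
  ∀ f : Lp ℂ 2 μ, A f =ᵐ[μ] fun x => φ x * f x

theorem isMultiplicationBy_standardProjection {E : Set X} (hE : MeasurableSet E) :
    IsMultiplicationBy (standardProjection μ hE) (E.indicator 1) := by
  intro f
  filter_upwards [standardProjection_coeFn μ hE f] with x hx
  rw [hx]
  by_cases hxE : x ∈ E
  · simp [hxE]
  · simp [hxE]

namespace IsMultiplicationBy

variable {A B : Lp ℂ 2 μ →L[ℂ] Lp ℂ 2 μ} {φ ψ : X → ℂ}

theorem add (hA : IsMultiplicationBy A φ) (hB : IsMultiplicationBy B ψ) :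
    IsMultiplicationBy (A + B) (φ + ψ) := by
  intro f
  filter_upwards [hA f, hB f, Lp.coeFn_add (A f) (B f)] with x h1 h2 h3
  rw [add_apply, h3, Pi.add_apply, h1, h2, Pi.add_apply, add_mul]

theorem smul (hA : IsMultiplicationBy A φ) (c : ℂ) :
    IsMultiplicationBy (c • A) (c • φ) := by
  intro f
  filter_upwards [hA f, Lp.coeFn_smul c (A f)] with x h1 h3
  rw [smul_apply, h3, Pi.smul_apply, h1, Pi.smul_apply, smul_mul_assoc]

theorem eq_of_ae (hA : IsMultiplicationBy A φ) (hB : IsMultiplicationBy B ψ)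
    (h : ∀ f : Lp ℂ 2 μ, ∀ᵐ x ∂μ, f x ≠ 0 → φ x = ψ x) : A = B := by
  ext1 f
  apply Lp.ext
  filter_upwards [hA f, hB f, h f] with x h1 h2 h3
  rw [h1, h2]
  by_cases hx : f x = 0
  · rw [hx, mul_zero, mul_zero]
  · rw [h3 hx]

theorem mul_comm (hA : IsMultiplicationBy A φ) (hB : IsMultiplicationBy B ψ) :
    A * B = B * A := by
  ext1 f
  apply Lp.ext
  filter_upwards [hA (B f), hB f, hB (A f), hA f] with x h1 h2 h3 h4
  rw [mul_apply_eq_comp, mul_apply_eq_comp, h1, h2, h3, h4, mul_left_comm]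

theorem tendsto_ofCLM {A : ℕ → Lp ℂ 2 μ →L[ℂ] Lp ℂ 2 μ} {φ : ℕ → X → ℂ}
    {B : Lp ℂ 2 μ →L[ℂ] Lp ℂ 2 μ} (hA : ∀ k, IsMultiplicationBy (A k) (φ k))
    (hB : IsMultiplicationBy B ψ) {c : ℝ} (hc : ∀ k x, ‖φ k x‖ ≤ c)
    (hlim : ∀ᵐ x ∂μ, Tendsto (fun k => φ k x) atTop (𝓝 (ψ x))) :
    Tendsto (fun k => ContinuousLinearMapWOT.ofCLM (A k)) atTop
      (𝓝 (ContinuousLinearMapWOT.ofCLM B)) := by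
  rw [ContinuousLinearMapWOT.tendsto_iff_forall_dual_apply_tendsto]
  intro f y
  obtain ⟨g, rfl⟩ := (InnerProductSpace.toDual ℂ (Lp ℂ 2 μ)).surjective y
  simp only [InnerProductSpace.toDual_apply_apply, ContinuousLinearMapWOT.ofCLM_apply, L2.inner_def]
  refine tendsto_integral_of_dominated_convergence (fun x => c * ‖inner ℂ (g x) (f x)‖)
    (fun k => (L2.integrable_inner (𝕜 := ℂ) g (A k f)).aestronglyMeasurable)
    ((L2.integrable_inner (𝕜 := ℂ) g f).norm.const_mul c) ?_ ?_
  · intro k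
    filter_upwards [hA k f] with x hx
    rw [hx, ← smul_eq_mul, inner_smul_right, norm_mul]
    exact mul_le_mul_of_nonneg_right (hc k x) (norm_nonneg _)
  · filter_upwards [hlim, ae_all_iff.2 fun k => hA k f, hB f] with x h1 h2 h3
    simp only [h2, h3, ← smul_eq_mul, inner_smul_right]
    simpa only [smul_eq_mul] using h1.mul_const _

end IsMultiplicationBy

/-- Multiplication by a bounded function, as a bounded operator. -/
def multiplicationOperator (φ : Lp ℂ ∞ μ) : Lp ℂ 2 μ →L[ℂ] Lp ℂ 2 μ :=
  (ContinuousLinearMap.mul ℂ ℂ).holderL μ ∞ 2 2 φ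

theorem isMultiplicationBy_multiplicationOperator (φ : Lp ℂ ∞ μ) :
    IsMultiplicationBy (multiplicationOperator φ) φ := by
  intro f
  exact (ContinuousLinearMap.mul ℂ ℂ).coeFn_holder φ f

theorem IsCarrier.exists_ne_zero {S : Set X} (hS : IsCarrier μ S) :
    ∃ g : Lp ℂ 2 μ, ∀ᵐ x ∂μ, x ∈ S → g x ≠ 0 := by
  have := hS.sigmaFinite
  obtain ⟨g, hg0, hgm, hg⟩ := exists_pos_lintegral_lt_of_sigmaFinite (μ.restrict S)
    (ε := 1) one_ne_zero
  let f : X → ℂ := S.indicator fun x => ((Real.sqrt (g x) : ℝ) : ℂ)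
  have hfm : Measurable f := by
    refine Measurable.indicator ?_ hS.measurableSet
    fun_prop
  have hf : MemLp f 2 μ := by
    rw [memLp_two_iff_integrable_sq_norm hfm.aestronglyMeasurable]
    have : (fun x => ‖f x‖ ^ 2) = S.indicator fun x => (g x : ℝ) := by
      funext x
      by_cases hx : x ∈ S
      · simp [f, hx, Real.sq_sqrt]
      · simp [f, hx]
    rw [this, integrable_indicator_iff hS.measurableSet]
    refine ⟨by fun_prop, ?_⟩
    rw [HasFiniteIntegral]
    simpa using hg.trans ENNReal.one_lt_top
  refine ⟨hf.toLp f, ?_⟩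
  filter_upwards [hf.coeFn_toLp] with x hx hxS
  rw [hx]
  simpa [f, hxS, Real.sqrt_eq_zero'] using (hg0 x).ne'

theorem norm_sq_eq_integral (f : Lp ℂ 2 μ) : ‖f‖ ^ 2 = ∫ x, ‖f x‖ ^ 2 ∂μ := by
  have h := congrArg RCLike.re (L2.inner_def (𝕜 := ℂ) f f)
  rw [inner_self_eq_norm_sq, ← integral_re (L2.integrable_inner (𝕜 := ℂ) f f)] at h
  rw [h]
  simp only [inner_self_eq_norm_sq]

/-- Let `E` be the set where the bound fails. Commutation gives `‖P_E A g‖ = ‖A P_E g‖ ≤ ‖A‖ ‖P_E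
g‖`, while pointwise on `E` the inequality is strict the other way, so `E` is null. -/
theorem norm_apply_ae_le_of_commute {A : Lp ℂ 2 μ →L[ℂ] Lp ℂ 2 μ}
    (hA : ∀ (E : Set X) (hE : MeasurableSet E), A * standardProjection μ hE =
      standardProjection μ hE * A) (g : Lp ℂ 2 μ) : ∀ᵐ x ∂μ, ‖A g x‖ ≤ ‖A‖ * ‖g x‖ := by
  have hgm : Measurable g := (Lp.stronglyMeasurable g).measurable
  have hAm : Measurable (A g) := (Lp.stronglyMeasurable (A g)).measurable
  let E : Set X := {x | ‖A‖ * ‖g x‖ < ‖A g x‖}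
  have hE : MeasurableSet E := measurableSet_lt (hgm.norm.const_mul _) hAm.norm
  have hint : ∀ f : Lp ℂ 2 μ, Integrable (fun x => ‖f x‖ ^ 2) μ := fun f =>
    (memLp_two_iff_integrable_sq_norm (Lp.aestronglyMeasurable f)).1 (Lp.memLp f)
  have hle : ∫ x, ‖standardProjection μ hE (A g) x‖ ^ 2 ∂μ ≤
      ∫ x, ‖A‖ ^ 2 * ‖standardProjection μ hE g x‖ ^ 2 ∂μ := by
    rw [integral_const_mul, ← norm_sq_eq_integral, ← norm_sq_eq_integral, ← mul_pow]
    have h := DFunLike.congr_fun (hA E hE) g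
    rw [mul_apply_eq_comp, mul_apply_eq_comp] at h
    rw [← h]
    exact pow_le_pow_left₀ (norm_nonneg _) (A.le_opNorm _) 2
  have hpt : ∀ᵐ x ∂μ, 0 ≤ ‖standardProjection μ hE (A g) x‖ ^ 2 -
      ‖A‖ ^ 2 * ‖standardProjection μ hE g x‖ ^ 2 := by
    filter_upwards [standardProjection_coeFn μ hE (A g), standardProjection_coeFn μ hE g]
      with x h1 h2
    rw [h1, h2]
    by_cases hx : x ∈ E
    · rw [Set.indicator_of_mem hx, Set.indicator_of_mem hx, ← mul_pow, sub_nonneg]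
      exact pow_le_pow_left₀ (by positivity) (le_of_lt hx) 2
    · simp [hx]
  have hzero := (integral_eq_zero_iff_of_nonneg_ae hpt
    ((hint _).sub ((hint _).const_mul _))).1 (le_antisymm (by
      rw [integral_sub (hint _) ((hint _).const_mul _)]
      linarith) (integral_nonneg_of_ae hpt))
  filter_upwards [hzero, standardProjection_coeFn μ hE (A g), standardProjection_coeFn μ hE g]
    with x h0 h1 h2
  by_contra hx
  have hxE : x ∈ E := not_le.1 hx
  rw [h1, h2, Set.indicator_of_mem hxE, Set.indicator_of_mem hxE, ← mul_pow, Pi.zero_apply,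
    sub_eq_zero] at h0
  exact (pow_lt_pow_left₀ (show ‖A‖ * ‖g x‖ < ‖A g x‖ from hxE) (by positivity)
    two_ne_zero).ne' h0

/-- A vector `g` non-zero almost everywhere on the carrier is cyclic for the standard projections.
So `A` is determined by `A g` and must be multiplication by `A g / g`, bounded by the preceding
estimate. -/
theorem IsCarrier.mem_multiplicationOperators_of_commute {S : Set X} (hS : IsCarrier μ S)
    {A : Lp ℂ 2 μ →L[ℂ] Lp ℂ 2 μ} (hA : ∀ (E : Set X) (hE : MeasurableSet E),
      A * standardProjection μ hE = standardProjection μ hE * A) :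
    A ∈ multiplicationOperators μ := by
  obtain ⟨g, hg⟩ := hS.exists_ne_zero
  have hgm : Measurable g := (Lp.stronglyMeasurable g).measurable
  have hAm : Measurable (A g) := (Lp.stronglyMeasurable (A g)).measurable
  have hφ : MemLp (fun x => A g x / g x) ∞ μ := by
    refine memLp_top_of_bound (hAm.div hgm).aestronglyMeasurable ‖A‖ ?_
    filter_upwards [norm_apply_ae_le_of_commute hA g] with x hx
    rw [norm_div]
    exact div_le_of_le_mul₀ (norm_nonneg _) (norm_nonneg _) hx
  obtain ⟨φ, hφ'⟩ : ∃ φ : Lp ℂ ∞ μ, φ =ᵐ[μ] fun x => A g x / g x := ⟨hφ.toLp _, hφ.coeFn_toLp⟩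
  have hM := isMultiplicationBy_multiplicationOperator φ
  refine ⟨φ, ?_⟩
  suffices h : A = multiplicationOperator φ by
    intro f
    rw [h]
    exact hM f
  have hAg : A g = multiplicationOperator φ g := by
    apply Lp.ext
    filter_upwards [hM g, hφ', hg, hS.vanish g, hS.vanish (A g)] with x h1 h2 h3 h4 h5
    rw [h1, h2]
    by_cases hx : x ∈ S
    · exact (div_mul_cancel₀ _ (h3 hx)).symm
    · rw [h4 hx, h5 hx, mul_zero]
  let N : Submodule ℂ (Lp ℂ 2 μ) :=
    LinearMap.ker (A - multiplicationOperator φ).toLinearMap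
  have hNc : IsClosed (N : Set (Lp ℂ 2 μ)) :=
    (A - multiplicationOperator φ).isClosed_ker
  have hNP : ∀ (E : Set X) (hE : MeasurableSet E), standardProjection μ hE g ∈ N := by
    intro E hE
    rw [LinearMap.mem_ker]
    change A (standardProjection μ hE g) -
      multiplicationOperator φ (standardProjection μ hE g) = 0
    have h1 := DFunLike.congr_fun (hA E hE) g
    have h2 := DFunLike.congr_fun (hM.mul_comm (isMultiplicationBy_standardProjection hE)) g
    rw [mul_apply_eq_comp, mul_apply_eq_comp] at h1 h2
    rw [h1, h2, hAg, sub_self]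
  have hN : N = ⊤ := by
    have : CompleteSpace N := hNc.completeSpace_coe
    rw [← Submodule.orthogonal_eq_bot_iff, eq_bot_iff]
    intro f hf
    rw [Submodule.mem_bot, Lp.eq_zero_iff_ae_eq_zero]
    have h0 : (fun x => inner ℂ (f x) (g x)) =ᵐ[μ] 0 := by
      refine (L2.integrable_inner (𝕜 := ℂ) f g).ae_eq_zero_of_forall_setIntegral_eq_zero ?_
      intro E hE _
      rw [← inner_standardProjection hE]
      exact Submodule.inner_left_of_mem_orthogonal (hNP E hE) hf
    filter_upwards [h0, hg, hS.vanish f] with x h1 h2 h3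
    by_cases hx : x ∈ S
    · rw [RCLike.inner_apply, Pi.zero_apply, mul_eq_zero] at h1
      rcases h1 with h1 | h1
      · exact absurd h1 (h2 hx)
      · exact (map_eq_zero _).1 h1
    · exact h3 hx
  ext1 f
  have hf : f ∈ N := hN ▸ Submodule.mem_top
  exact sub_eq_zero.1 (LinearMap.mem_ker.1 hf)

/-- The commutant of the standard projections is a weakly closed subspace containing `Λ`, and it
consists of multiplications. -/
theorem IsCarrier.closure_span_subset {S : Set X} (hS : IsCarrier μ S)
    {Λ : Set (Lp ℂ 2 μ →L[ℂ] Lp ℂ 2 μ)} (hΛ : ∀ P ∈ Λ, IsStandardProjection P) :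
    closure (Submodule.span ℂ (ContinuousLinearMapWOT.ofCLM '' Λ) :
        Set (Lp ℂ 2 μ →WOT[ℂ] Lp ℂ 2 μ)) ⊆
      ContinuousLinearMapWOT.ofCLM '' multiplicationOperators μ := by
  let C : Submodule ℂ (Lp ℂ 2 μ →WOT[ℂ] Lp ℂ 2 μ) :=
    { carrier := {A | ∀ (E : Set X) (hE : MeasurableSet E) (f : Lp ℂ 2 μ),
        A (standardProjection μ hE f) = standardProjection μ hE (A f)}
      zero_mem' := fun E hE f => (map_zero (standardProjection μ hE)).symm
      add_mem' := fun {A B} hA hB E hE f => by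
        rw [ContinuousLinearMapWOT.add_apply, ContinuousLinearMapWOT.add_apply, map_add, hA E hE f,
          hB E hE f]
      smul_mem' := fun c A hA E hE f => by
        rw [ContinuousLinearMapWOT.smul_apply, ContinuousLinearMapWOT.smul_apply, map_smul,
          hA E hE f] }
  have hC : IsClosed (C : Set (Lp ℂ 2 μ →WOT[ℂ] Lp ℂ 2 μ)) := by
    have : (C : Set (Lp ℂ 2 μ →WOT[ℂ] Lp ℂ 2 μ)) =
        ⋂ (E : Set X) (hE : MeasurableSet E) (f : Lp ℂ 2 μ) (y : StrongDual ℂ (Lp ℂ 2 μ)),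
          {A | y (A (standardProjection μ hE f)) = (y.comp (standardProjection μ hE)) (A f)} := by
      ext A
      simp only [Set.mem_iInter, Set.mem_ofPred_eq]
      constructor
      · intro hA E hE f y
        rw [hA E hE f]
        rfl
      · intro hA E hE f
        refine (SeparatingDual.eq_iff_forall_dual_eq (R := ℂ)).2 fun y => ?_
        exact hA E hE f y
    rw [this]
    refine isClosed_iInter fun E => isClosed_iInter fun hE => isClosed_iInter fun f =>
      isClosed_iInter fun y => ?_
    exact isClosed_eq (ContinuousLinearMapWOT.continuous_dual_apply _ _)
      (ContinuousLinearMapWOT.continuous_dual_apply _ _)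
  have hle : Submodule.span ℂ (ContinuousLinearMapWOT.ofCLM '' Λ) ≤ C := by
    rw [Submodule.span_le]
    rintro _ ⟨P, hP, rfl⟩ E hE f
    obtain ⟨F, hF, rfl⟩ := hΛ P hP
    exact DFunLike.congr_fun ((isMultiplicationBy_standardProjection hF).mul_comm
      (isMultiplicationBy_standardProjection hE)) f
  intro A hA
  refine ⟨A.toCLM, hS.mem_multiplicationOperators_of_commute fun E hE => ?_, rfl⟩
  ext1 f
  exact closure_minimal hle hC hA E hE f

theorem multiplicationOperators_subset {V : Submodule ℂ (Lp ℂ 2 μ →WOT[ℂ] Lp ℂ 2 μ)}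
    (hV : IsClosed (V : Set (Lp ℂ 2 μ →WOT[ℂ] Lp ℂ 2 μ)))
    (hP : ∀ (E : Set X) (hE : MeasurableSet E),
      ContinuousLinearMapWOT.ofCLM (standardProjection μ hE) ∈ V) :
    ContinuousLinearMapWOT.ofCLM '' multiplicationOperators μ ⊆ (V : Set _) := by
  have hsimple : ∀ s : SimpleFunc X ℂ, ∃ A, ContinuousLinearMapWOT.ofCLM A ∈ V ∧
      IsMultiplicationBy (μ := μ) A s := by
    intro s
    induction s using SimpleFunc.induction with
    | const c hs =>
      rename_i E
      refine ⟨c • standardProjection μ hs, V.smul_mem c (hP E hs), ?_⟩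
      convert (isMultiplicationBy_standardProjection (μ := μ) hs).smul c using 1
      funext x
      by_cases hx : x ∈ E
      · simp [hx]
      · simp [hx]
    | add _ hf hg =>
      obtain ⟨A, hA, hA'⟩ := hf
      obtain ⟨B, hB, hB'⟩ := hg
      exact ⟨A + B, V.add_mem hA hB, hA'.add hB'⟩
  rintro _ ⟨B, ⟨φ, hφ⟩, rfl⟩
  have hbd : ∃ c : ℝ, ∀ᵐ x ∂μ, ‖φ x‖ ≤ c :=
    ⟨(eLpNormEssSup φ μ).toReal, by
      have hfin : eLpNormEssSup φ μ ≠ ∞ := by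
        have := Lp.eLpNorm_ne_top φ
        rwa [eLpNorm_exponent_top] at this
      filter_upwards [enorm_ae_le_eLpNormEssSup φ μ] with x hx
      rw [← toReal_enorm]
      exact ENNReal.toReal_mono hfin hx⟩
  obtain ⟨c, hc⟩ := hbd
  have hφm := Lp.stronglyMeasurable φ
  choose A hA hA' using fun k => hsimple (hφm.approxBounded (max c 0) k)
  refine hV.mem_of_tendsto (IsMultiplicationBy.tendsto_ofCLM hA' hφ (c := max c 0) ?_ ?_)
    (Eventually.of_forall hA)
  · exact fun k x => hφm.norm_approxBounded_le (le_max_right _ _) k x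
  · refine hφm.tendsto_approxBounded_ae ?_
    filter_upwards [hc] with x hx
    exact hx.trans (le_max_left _ _)

/-! ### A separating function refining the levels -/

/-- A measurable embedding of the space of complex sequences into the open unit interval. -/
def unitCode (z : ℕ → ℂ) : ℝ := Real.sigmoid (embeddingReal (ℕ → ℂ) z)

theorem measurableEmbedding_unitCode : MeasurableEmbedding unitCode :=
  (MeasurableEmbedding.subtype_coe measurableSet_Icc).comp
    (measurableEmbedding_sigmoid_comp_embeddingReal (α := ℕ → ℂ))

/-- `H` is the level plus a code in `(0, 1)` of the values of a dense sequence of `L²`. The integer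
part records the level, and the fractional part generates all measurable sets modulo null sets on
the carrier. -/
theorem IsCarrier.exists_separating_function [TopologicalSpace.SeparableSpace (Lp ℂ 2 μ)]
    {S : Set X} (hS : IsCarrier μ S) {lev : X → ℕ} (hlev : Measurable lev) :
    ∃ H : X → ℝ, Measurable H ∧ (∀ x (k : ℕ), H x < k ↔ lev x < k) ∧
      ∀ E, MeasurableSet E → ∃ B, MeasurableSet B ∧ ∀ᵐ x ∂μ.restrict S, x ∈ E ↔ H x ∈ B := by
  let d : ℕ → Lp ℂ 2 μ := TopologicalSpace.denseSeq _
  let F : X → ℕ → ℂ := fun x k => d k x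
  have hF : Measurable F :=
    measurable_pi_lambda _ fun k => (Lp.stronglyMeasurable (d k)).measurable
  have hpos : ∀ z, 0 < unitCode z := fun z => Real.sigmoid_pos _
  have hlt : ∀ z, unitCode z < 1 := fun z => Real.sigmoid_lt_one _
  refine ⟨fun x => lev x + unitCode (F x), ?_, ?_, ?_⟩
  · exact (measurable_from_nat.comp hlev).add (measurableEmbedding_unitCode.measurable.comp hF)
  · intro x k
    have h0 := hpos (F x)
    have h1 := hlt (F x)
    constructor
    · intro h
      have : (lev x : ℝ) < k := by linarith
      exact_mod_cast this
    · intro h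
      have : (lev x : ℝ) + 1 ≤ k := by exact_mod_cast h
      linarith
  · intro E hE
    obtain ⟨g, hg⟩ := hS.exists_ne_zero
    have hm : MeasurableSpace.comap F inferInstance ≤ ‹MeasurableSpace X› := hF.comap_le
    -- Almost everywhere measurability for the σ-algebra of `F` is closed in `L²` and holds on the
    -- dense sequence, hence for `P_E g`; on the carrier, `E` is where `P_E g` is non-zero.
    have hmeas : AEStronglyMeasurable[MeasurableSpace.comap F inferInstance]
        (standardProjection μ hE g) μ := by
      refine (isClosed_aestronglyMeasurable (F := ℂ) (p := 2) (μ := μ) hm).closure_subset_iff.2 ?_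
        (TopologicalSpace.denseRange_denseSeq (Lp ℂ 2 μ) (standardProjection μ hE g))
      rintro _ ⟨k, rfl⟩
      have : Measurable[MeasurableSpace.comap F inferInstance] (d k) :=
        (measurable_pi_apply k).comp (comap_measurable F)
      exact this.stronglyMeasurable.aestronglyMeasurable
    obtain ⟨g', hg', hgg'⟩ := hmeas
    obtain ⟨C, hC, hCg⟩ : ∃ C, MeasurableSet C ∧ F ⁻¹' C = g' ⁻¹' {0}ᶜ :=
      hg'.measurable (measurableSet_singleton 0).compl
    refine ⟨Int.fract ⁻¹' (unitCode '' C), ?_, ?_⟩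
    · exact measurable_fract (measurableEmbedding_unitCode.measurableSet_image.2 hC)
    · rw [ae_restrict_iff' hS.measurableSet]
      filter_upwards [hgg', hg, standardProjection_coeFn μ hE g] with x h1 h2 h3 hxS
      have hfr : Int.fract ((lev x : ℝ) + unitCode (F x)) = unitCode (F x) := by
        rw [Int.fract_natCast_add, Int.fract_eq_self.2 ⟨(hpos _).le, hlt _⟩]
      rw [Set.mem_preimage, hfr, measurableEmbedding_unitCode.injective.mem_set_image,
        ← Set.mem_preimage, hCg, Set.mem_preimage, Set.mem_compl_singleton_iff, ← h1, h3]
      by_cases hx : x ∈ E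
      · simp [hx, h2 hxS]
      · simp [hx]

theorem IsCarrier.standardProjection_congr {S : Set X} (hS : IsCarrier μ S) {E F : Set X}
    (hE : MeasurableSet E) (hF : MeasurableSet F) (h : ∀ᵐ x ∂μ.restrict S, x ∈ E ↔ x ∈ F) :
    standardProjection μ hE = standardProjection μ hF := by
  refine (isMultiplicationBy_standardProjection hE).eq_of_ae
    (isMultiplicationBy_standardProjection hF) fun f => ?_
  filter_upwards [hS.vanish f, (ae_restrict_iff' hS.measurableSet).1 h] with x h1 h2 hx
  have h3 := h2 (by_contra fun hxS => hx (h1 hxS))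
  by_cases hxE : x ∈ E
  · rw [Set.indicator_of_mem hxE, Set.indicator_of_mem (h3.1 hxE)]
  · rw [Set.indicator_of_notMem hxE, Set.indicator_of_notMem fun hxF => hxE (h3.2 hxF)]

/-- A π-λ argument: complements use the identity operator, and countable disjoint unions are weak
limits of finite sums by dominated convergence. -/
theorem standardProjection_preimage_mem {V : Submodule ℂ (Lp ℂ 2 μ →WOT[ℂ] Lp ℂ 2 μ)}
    (hV : IsClosed (V : Set (Lp ℂ 2 μ →WOT[ℂ] Lp ℂ 2 μ))) {H : X → ℝ} (hH : Measurable H)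
    (huniv : ContinuousLinearMapWOT.ofCLM (standardProjection μ MeasurableSet.univ) ∈ V)
    (hIio : ∀ t : ℝ, ContinuousLinearMapWOT.ofCLM
      (standardProjection μ (hH (measurableSet_Iio (a := t)))) ∈ V)
    {B : Set ℝ} (hB : MeasurableSet B) :
    ContinuousLinearMapWOT.ofCLM (standardProjection μ (hH hB)) ∈ V := by
  induction B, hB using MeasurableSpace.induction_on_inter
    (borel_eq_generateFrom_Iio ℝ ▸ BorelSpace.measurable_eq) isPiSystem_Iio with
  | empty =>
    have h : standardProjection μ (hH MeasurableSet.empty) = 0 := by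
      refine (isMultiplicationBy_standardProjection (hH MeasurableSet.empty)).eq_of_ae
        (ψ := 0) ?_ fun f => Eventually.of_forall fun x _ => by simp
      intro f
      filter_upwards [Lp.coeFn_zero ℂ 2 μ] with x hx
      rw [zero_apply, hx, Pi.zero_apply, zero_mul]
    rw [h]
    exact V.zero_mem
  | basic B hB =>
    obtain ⟨t, rfl⟩ := hB
    exact hIio t
  | compl B hB ih =>
    have h : standardProjection μ (hH hB.compl) =
        standardProjection μ MeasurableSet.univ + (-1 : ℂ) • standardProjection μ (hH hB) := by
      refine (isMultiplicationBy_standardProjection (hH hB.compl)).eq_of_ae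
        ((isMultiplicationBy_standardProjection MeasurableSet.univ).add
          ((isMultiplicationBy_standardProjection (hH hB)).smul (-1)))
        fun f => Eventually.of_forall fun x _ => ?_
      by_cases hx : H x ∈ B
      · simp [hx]
      · simp [hx]
    rw [h]
    exact V.add_mem huniv (V.smul_mem _ ih)
  | iUnion B hd hB ih =>
    let Q : ℕ → Lp ℂ 2 μ →L[ℂ] Lp ℂ 2 μ := fun k =>
      ∑ i ∈ Finset.range k, standardProjection μ (hH (hB i))
    have hQV : ∀ k, ContinuousLinearMapWOT.ofCLM (Q k) ∈ V := by
      intro k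
      induction k with
      | zero => exact V.zero_mem
      | succ k hk =>
        simp only [Q, Finset.sum_range_succ]
        exact V.add_mem hk (ih k)
    have hsplit : ∀ k x, (H ⁻¹' ⋃ i ∈ Finset.range (k + 1), B i).indicator (1 : X → ℂ) x =
        (H ⁻¹' ⋃ i ∈ Finset.range k, B i).indicator (1 : X → ℂ) x +
          (H ⁻¹' B k).indicator (1 : X → ℂ) x := by
      intro k x
      have h1 : (H ⁻¹' ⋃ i ∈ Finset.range (k + 1), B i) =
          (H ⁻¹' ⋃ i ∈ Finset.range k, B i) ∪ H ⁻¹' B k := by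
        rw [Finset.range_add_one, Finset.set_biUnion_insert, Set.preimage_union, Set.union_comm]
      rw [h1, Set.indicator_union_of_disjoint]
      rw [Set.disjoint_left]
      intro y hy hyk
      obtain ⟨i, hi, hyi⟩ := Set.mem_iUnion₂.1 (Set.mem_preimage.1 hy)
      exact Set.disjoint_left.1 (hd (Finset.mem_range.1 hi).ne) hyi hyk
    have hQ : ∀ k, IsMultiplicationBy (Q k)
        ((H ⁻¹' ⋃ i ∈ Finset.range k, B i).indicator 1) := by
      intro k
      induction k with
      | zero =>
        intro f
        filter_upwards [Lp.coeFn_zero ℂ 2 μ] with x hx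
        simpa [Q] using hx
      | succ k hk =>
        simp only [Q, Finset.sum_range_succ]
        convert hk.add (isMultiplicationBy_standardProjection (hH (hB k))) using 1
        funext x
        exact hsplit k x
    refine hV.mem_of_tendsto (IsMultiplicationBy.tendsto_ofCLM hQ
      (isMultiplicationBy_standardProjection _) (c := 1) ?_ ?_) (Eventually.of_forall hQV)
    · intro k x
      by_cases hx : x ∈ H ⁻¹' ⋃ i ∈ Finset.range k, B i
      · rw [Set.indicator_of_mem hx, Pi.one_apply, norm_one]
      · rw [Set.indicator_of_notMem hx, norm_zero]
        exact zero_le_one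
    · refine Eventually.of_forall fun x => tendsto_const_nhds.congr' ?_
      by_cases hx : H x ∈ ⋃ i, B i
      · obtain ⟨i, hi⟩ := Set.mem_iUnion.1 hx
        filter_upwards [eventually_gt_atTop i] with k hk
        rw [Set.indicator_of_mem (Set.mem_preimage.2 hx), Set.indicator_of_mem]
        exact Set.mem_iUnion₂.2 ⟨i, Finset.mem_range.2 hk, hi⟩
      · refine Eventually.of_forall fun k => ?_
        beta_reduce
        rw [Set.indicator_of_notMem (s := H ⁻¹' ⋃ i, B i) hx, Set.indicator_of_notMem]
        intro h
        obtain ⟨i, -, hi⟩ := Set.mem_iUnion₂.1 (Set.mem_preimage.1 h)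
        exact hx (Set.mem_iUnion.2 ⟨i, hi⟩)

/-! ### Multiplicity-free triangularization -/

/-- Modulo null sets, `B` either contains every level or lies between `{ℓ < i}` and `{ℓ < i + 1}`. A
non-zero pairing from outside `B` into `B` can then occur only within level `i`, at a loop; the
fibre of that loop is an atom, which `B` contains or misses. -/
theorem apply_mem_standardSubspace_of_comparable {S : Set X} (hS : IsCarrier μ S)
    (hrep : ∀ h, K h = ∑ i, inner ℂ (v i) h • u i) (hinc : HasIncreasingSpectrum K)
    {ℓ : KernelType n → ℕ} {M : ℕ} (hℓ : IsLevelFunction (essTypes S u v) ℓ M) {B : Set X}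
    (hB : MeasurableSet B)
    (hcomp : ∀ k : ℕ, μ.restrict S (B \ {x | ℓ (typeMap u v x) < k}) = 0 ∨
      μ.restrict S ({x | ℓ (typeMap u v x) < k} \ B) = 0)
    {f : Lp ℂ 2 μ} (hf : f ∈ standardSubspace μ B) : K f ∈ standardSubspace μ B := by
  refine apply_ae_eq_zero_of_kern_eq_zero hS hrep (A := Bᶜ) hf ?_
  by_cases hall : ∀ k : ℕ, μ.restrict S ({x | ℓ (typeMap u v x) < k} \ B) = 0
  · filter_upwards [ae_all_iff.2 fun k => measure_eq_zero_iff_ae_notMem.1 (hall k)] with x hx hxB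
    exact absurd ⟨Nat.lt_succ_self (ℓ (typeMap u v x)), hxB⟩ (hx _)
  -- This is the last level threshold contained in `B`: were there none, comparability would carry
  -- containment from each `k` to `k + 1`.
  obtain ⟨i, hlow, hhigh⟩ : ∃ i : ℕ, μ.restrict S ({x | ℓ (typeMap u v x) < i} \ B) = 0 ∧
      μ.restrict S (B \ {x | ℓ (typeMap u v x) < i + 1}) = 0 := by
    by_contra! hne
    refine hall fun k => ?_
    induction k with
    | zero => simp
    | succ k ih => exact (hcomp (k + 1)).resolve_left (hne k ih)
  have hlow' := measure_eq_zero_iff_ae_notMem.1 hlow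
  have hhigh' := measure_eq_zero_iff_ae_notMem.1 hhigh
  have hloop : ∀ᵐ x ∂μ.restrict S, x ∉ B → ∀ᵐ y ∂μ.restrict S, y ∈ B →
      ℓ (typeMap u v x) = i → kern (typeMap u v x) (typeMap u v x) ≠ 0 →
        typeMap u v x ≠ typeMap u v y := by
    by_cases hp : ∃ p ∈ essTypes S u v, kern p p ≠ 0 ∧ ℓ p = i
    · obtain ⟨p, hpR, hpp, hpi⟩ := hp
      have ha := isAtomOf_preimage_of_loop hS hrep hinc hpR hpp
      rcases ha.dichotomy (typeMap u v ⁻¹' {p} ∩ B) Set.inter_subset_left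
        (ha.measurableSet.inter hB) with h | h
      · filter_upwards [ae_typeMap_mem_essTypes (u := u) (v := v) S] with x hxR hxB
        filter_upwards [measure_eq_zero_iff_ae_notMem.1 h] with y hy hyB hxi hxx hxy
        refine hy ⟨?_, hyB⟩
        rw [Set.mem_preimage, Set.mem_singleton_iff, ← hxy]
        exact (hℓ.eq_of_loop p hpR _ hxR hpp (hpi.trans hxi.symm)).symm
      · filter_upwards [ae_typeMap_mem_essTypes (u := u) (v := v) S,
          measure_eq_zero_iff_ae_notMem.1 h] with x hxR hx hxB
        refine Eventually.of_forall fun y hyB hxi hxx hxy => hx ⟨?_, fun h' => hxB h'.2⟩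
        exact (hℓ.eq_of_loop p hpR _ hxR hpp (hpi.trans hxi.symm)).symm
    · filter_upwards [ae_typeMap_mem_essTypes (u := u) (v := v) S] with x hxR hxB
      exact Eventually.of_forall fun y hyB hxi hxx hxy => hp ⟨_, hxR, hxx, hxi⟩
  filter_upwards [hlow', hloop, ae_typeMap_mem_essTypes (u := u) (v := v) S] with x h1 h2 hxR hxB
  filter_upwards [hhigh', h2 hxB, ae_typeMap_mem_essTypes (u := u) (v := v) S] with y h3 h4 hyR hyB
  by_contra hker
  have hxi : i ≤ ℓ (typeMap u v x) := by
    by_contra hlt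
    exact h1 ⟨not_le.1 hlt, hxB⟩
  have hyi : ℓ (typeMap u v y) < i + 1 := by
    by_contra hlt
    exact h3 ⟨hyB, hlt⟩
  rcases hℓ.triangular _ hxR _ hyR hker with h | h
  · omega
  · refine h4 hyB ?_ ?_ h
    · rw [← h] at hyi
      omega
    · rw [← h] at hker
      exact hker

/-- Maximality is taken among all standard subspaces, with no invariance imposed on the chain;
invariance follows later from comparability with the levels. -/
theorem exists_maximal_standard_chain {Λ₀ : Set (Lp ℂ 2 μ →L[ℂ] Lp ℂ 2 μ)}
    (hΛ₀ : ∀ P ∈ Λ₀, IsStandardProjection P)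
    (hchain : ∀ P ∈ Λ₀, ∀ Q ∈ Λ₀,
      LinearMap.range P.toLinearMap ≤ LinearMap.range Q.toLinearMap ∨
        LinearMap.range Q.toLinearMap ≤ LinearMap.range P.toLinearMap) :
    ∃ Λ : Set (Lp ℂ 2 μ →L[ℂ] Lp ℂ 2 μ), Λ₀ ⊆ Λ ∧ (∀ P ∈ Λ, IsStandardProjection P) ∧
      (∀ P ∈ Λ, ∀ Q ∈ Λ, LinearMap.range P.toLinearMap ≤ LinearMap.range Q.toLinearMap ∨
        LinearMap.range Q.toLinearMap ≤ LinearMap.range P.toLinearMap) ∧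
      ∀ Q : Lp ℂ 2 μ →L[ℂ] Lp ℂ 2 μ, IsStandardProjection Q →
        (∀ P ∈ Λ, LinearMap.range P.toLinearMap ≤ LinearMap.range Q.toLinearMap ∨
          LinearMap.range Q.toLinearMap ≤ LinearMap.range P.toLinearMap) → Q ∈ Λ := by
  let r : {P : Lp ℂ 2 μ →L[ℂ] Lp ℂ 2 μ // IsStandardProjection P} →
      {P : Lp ℂ 2 μ →L[ℂ] Lp ℂ 2 μ // IsStandardProjection P} → Prop := fun P Q =>
    LinearMap.range P.1.toLinearMap ≤ LinearMap.range Q.1.toLinearMap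
  have hc : IsChain r {P | P.1 ∈ Λ₀} := fun P hP Q hQ _ => hchain P.1 hP Q.1 hQ
  obtain ⟨N, hN, hsub⟩ := hc.exists_maxChain
  refine ⟨Subtype.val '' N, fun P hP => ⟨⟨P, hΛ₀ P hP⟩, hsub hP, rfl⟩, ?_, ?_, ?_⟩
  · rintro _ ⟨P, -, rfl⟩
    exact P.2
  · rintro _ ⟨P, hP, rfl⟩ _ ⟨Q, hQ, rfl⟩
    by_cases hPQ : P = Q
    · exact Or.inl (hPQ ▸ le_rfl)
    · exact hN.1 hP hQ hPQ
  · intro Q hQ hcomp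
    have hins : IsChain r (insert ⟨Q, hQ⟩ N) :=
      hN.1.insert fun P hP _ => (hcomp P.1 ⟨P, hP, rfl⟩).symm
    have heq := hN.2 hins (Set.subset_insert _ _)
    exact ⟨⟨Q, hQ⟩, heq ▸ Set.mem_insert _ _, rfl⟩

theorem standardSubspace_mono {E F : Set X} (h : E ⊆ F) :
    standardSubspace μ E ≤ standardSubspace μ F := by
  intro f hf
  filter_upwards [mem_standardSubspace.1 hf] with x hx hxF
  exact hx fun hxE => hxF (h hxE)

theorem exists_multiplicityFree_triangularization [TopologicalSpace.SeparableSpace (Lp ℂ 2 μ)]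
    {S : Set X} (hS : IsCarrier μ S) (hrep : ∀ h, K h = ∑ i, inner ℂ (v i) h • u i)
    (hinc : HasIncreasingSpectrum K) {ℓ : KernelType n → ℕ} {M : ℕ}
    (hℓ : IsLevelFunction (essTypes S u v) ℓ M) : AdmitsMultiplicityFreeTriangularization K := by
  obtain ⟨H, hH, hHlev, hHsep⟩ :=
    hS.exists_separating_function (hℓ.measurable.comp (measurable_typeMap (u := u) (v := v)))
  let P : ℝ → Lp ℂ 2 μ →L[ℂ] Lp ℂ 2 μ := fun t =>
    standardProjection μ (hH (measurableSet_Iio (a := t)))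
  obtain ⟨Λ, hPΛ, hstd, hchain, hmax⟩ := exists_maximal_standard_chain (Λ₀ := Set.range P)
    (by
      rintro _ ⟨t, rfl⟩
      exact ⟨_, _, rfl⟩)
    (by
      rintro _ ⟨s, rfl⟩ _ ⟨t, rfl⟩
      simp only [P, range_standardProjection]
      rcases le_total s t with h | h
      · exact Or.inl (standardSubspace_mono (Set.preimage_mono (Set.Iio_subset_Iio h)))
      · exact Or.inr (standardSubspace_mono (Set.preimage_mono (Set.Iio_subset_Iio h))))
  refine ⟨Λ, ⟨hstd, ?_, hchain, hmax⟩, Set.Subset.antisymm (hS.closure_span_subset hstd) ?_⟩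
  · intro Q hQ f hf
    obtain ⟨B, hB, rfl⟩ := hstd Q hQ
    rw [range_standardProjection] at hf ⊢
    refine apply_mem_standardSubspace_of_comparable hS hrep hinc hℓ hB (fun k => ?_) hf
    have hk : {x | ℓ (typeMap u v x) < k} = H ⁻¹' Set.Iio (k : ℝ) := by
      ext x
      exact (hHlev x k).symm
    have h := hchain _ hQ _ (hPΛ ⟨(k : ℝ), rfl⟩)
    simp only [P, range_standardProjection] at h
    rw [hS.standardSubspace_le_iff hB (hH measurableSet_Iio),
      hS.standardSubspace_le_iff (hH measurableSet_Iio) hB, ← hk] at h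
    exact h
  · rw [← Submodule.topologicalClosure_coe]
    have hmem : ∀ Q ∈ Λ, ContinuousLinearMapWOT.ofCLM Q ∈
        (Submodule.span ℂ (ContinuousLinearMapWOT.ofCLM '' Λ)).topologicalClosure :=
      fun Q hQ => Submodule.le_topologicalClosure _ (Submodule.subset_span ⟨Q, hQ, rfl⟩)
    refine multiplicationOperators_subset (Submodule.isClosed_topologicalClosure _) fun E hE => ?_
    obtain ⟨B, hB, hEB⟩ := hHsep E hE
    rw [hS.standardProjection_congr hE (hH hB) hEB]
    refine standardProjection_preimage_mem (Submodule.isClosed_topologicalClosure _) hH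
      (hmem _ (hmax _ ⟨_, _, rfl⟩ fun Q hQ => Or.inl ?_)) (fun t => hmem _ (hPΛ ⟨t, rfl⟩)) hB
    rw [range_standardProjection, standardSubspace_univ]
    exact le_top

end StdTri

end

theorem mainTheorem3 {X : Type*} [MeasurableSpace X] (μ : Measure X)
    [TopologicalSpace.SeparableSpace (Lp ℂ 2 μ)]
    (K : Lp ℂ 2 μ →L[ℂ] Lp ℂ 2 μ) (n : ℕ) (hn : 1 ≤ n)
    (hrank : LinearMap.rank K.toLinearMap = n)
    (hK : StdTri.HasIncreasingSpectrum K) :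
    StdTri.AdmitsMultiplicityFreeTriangularization K ∧
    ∃ (m : ℕ) (E : Fin m → Set X) (hE : ∀ j, MeasurableSet (E j)),
      1 ≤ m ∧ m ≤ 2 * n + 1 ∧
      Pairwise (fun i j => Disjoint (E i) (E j)) ∧ (⋃ j, E j) = Set.univ ∧
      (∀ j, StdTri.standardSubspace μ (E j) ≠ ⊥) ∧
      (∀ i j, j < i → StdTri.block K (hE i) (E j) = 0) ∧
      (∀ j, StdTri.block K (hE j) (E j) ≠ 0 →
        Module.finrank ℂ (StdTri.standardSubspace μ (E j)) = 1 ∧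
        ∃ c : ℂ, c ≠ 0 ∧ Module.End.HasEigenvalue K.toLinearMap c ∧
          StdTri.block K (hE j) (E j) =
            c • ContinuousLinearMap.id ℂ (StdTri.standardSubspace μ (E j))) := by
  obtain ⟨S, hS⟩ := StdTri.exists_isCarrier (μ := μ)
  obtain ⟨u, v, hrep⟩ := StdTri.exists_finite_rank_representation hrank
  obtain ⟨ℓ, hℓ⟩ := StdTri.exists_isLevelFunction (StdTri.not_hasPeriodicWalk hS hrep hK)
    (StdTri.isClosed_essTypes S).measurableSet
  have hK0 : K ≠ 0 := by
    rintro rfl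
    have h0 : LinearMap.rank (0 : Lp ℂ 2 μ →L[ℂ] Lp ℂ 2 μ).toLinearMap = 0 := LinearMap.rank_zero
    rw [h0] at hrank
    have : n = 0 := by exact_mod_cast hrank.symm
    omega
  exact ⟨StdTri.exists_multiplicityFree_triangularization hS hrep hK hℓ,
    StdTri.exists_block_triangular_partition hS hrep hK hK0 hℓ⟩
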